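/- For a finite graph $G=(V,E)$, write $d_u$ for the degree of a vertex $u$ and let $SO(G)=\sum_{uv\in E}\sqrt{d_u^2+d_v^2}$ be its Sombor index. Let $\mathcal D$ be a multiset of at least three natural numbers that is the degree sequence of some tree, and let $d_1\ge\dots\ge d_m$ be its entries greater than one (the internal degrees; $m\ge 1$). The *greedy tree* of $\mathcal D$ is constructed as follows. Label the root $d_1$; label the neighbors of the root $d_2,d_3,\dots$, giving each next neighbor the largest available degree. Then, level by level, for each labelled vertex in the current level, in non-increasing order of labels, label its children in turn with the largest available degree. When no internal degrees remain, add leaves so that the degree of each vertex equals its label. An *alternating greedy tree* for $(d_1,\dots,d_m)$ is any tree (up to isomorphism) produced by the following recursion. - If $m-1\le d_m$, take a root with $d_m$ children, of which $d_m-m+1$ are leaves and the others have degrees $d_1,\dots,d_{m-1}$; all children of these other vertices are leaves. - If $m-1\ge d_m+1$, let $T$ be the tree with a root $r$ having $d_m-1$ children, of degrees $d_1,\dots,d_{d_m-1}$, whose further neighbors are all leaves. Let $S$ be an alternating greedy tree for $(d_{d_m},\dots,d_{m-1})$, and let $v$ be any leaf of $S$ whose neighbor has the smallest degree among the neighbors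 of leaves of $S$. Identify $r$ with $v$. (Different choices of $v$ may produce non-isomorphic trees.) Then: 1. The greedy tree is a tree with degree sequence $\mathcal D$, and $SO(\text{greedy tree})\le SO(T)$ for every tree $T$ with degree sequence $\mathcal D$. 2. There is an alternating greedy tree for $\mathcal D$. Every alternating greedy tree $A$ for $\mathcal D$ is a tree with degree sequence $\mathcal D$, and $SO(T)\le SO(A)$ for every tree $T$ with degree sequence $\mathcal D$. -/

import Mathlib

namespace SomborTrees

open scoped Classical in
/-- The degree sequence of a finite graph, as the multiset of its vertex degrees. -/
noncomputable def degreeSequence {V : Type*} [Fintype V] (G : SimpleGraph V) : Multiset ℕ :=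
  (Finset.univ : Finset V).val.map fun v => G.degree v

/-- `G` is a tree with degree sequence `D`. -/
def IsTreeWithDegrees {V : Type*} [Fintype V] (D : Multiset ℕ) (G : SimpleGraph V) : Prop :=
  G.IsTree ∧ degreeSequence G = D

open scoped Classical in
/-- The Sombor index, the sum over the edges `uv` of `√(d_u² + d_v²)`. -/
noncomputable def somborIndex {V : Type*} [Fintype V] (G : SimpleGraph V) : ℝ :=
  ∑ e ∈ G.edgeFinset,
    Sym2.lift ⟨fun u v => √((G.degree u : ℝ) ^ 2 + (G.degree v : ℝ) ^ 2),
      fun u v => by simp only [add_comm]⟩ e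

/-! ### The greedy tree

The vertices are numbered `0, 1, 2, …` in the order in which they receive their labels, and the
labels are handed out in non-increasing order, so vertex `i` has label `d[i]`, where `d` is the
whole degree sequence in non-increasing order (the final entries `1` are the leaves). Vertex `0` is
the root. The vertices are then treated in the order of their numbers, which is level by level, and
in non-increasing order of labels within a level; each of them gets the next vertices as its
children, as many as its label asks for. -/

/-- The number of children of vertex `i`: the root has as many children as its label says, any
other vertex one less, since it also has a parent. -/
def greedyNumChildren (d : List ℕ) (i : ℕ) : ℕ :=
  if i = 0 then d.getD 0 0 else d.getD i 0 - 1

/-- The first number that is still free when the children of vertex `i` are to be labelled. -/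
def greedyFirstChild (d : List ℕ) : ℕ → ℕ
  | 0 => 1
  | i + 1 => greedyFirstChild d i + greedyNumChildren d i

/-- The greedy tree of the degree sequence `d`, given in non-increasing order. Vertex `j` is a child
of vertex `i` if it is one of the `greedyNumChildren d i` vertices from `greedyFirstChild d i` on. -/
def greedyTreeOfList (d : List ℕ) : SimpleGraph (Fin d.length) :=
  SimpleGraph.fromRel fun i j =>
    greedyFirstChild d i ≤ (j : ℕ) ∧ (j : ℕ) < greedyFirstChild d i + greedyNumChildren d i

/-- The greedy tree of a degree sequence. -/
def greedyTree (D : Multiset ℕ) : SimpleGraph (Fin (D.sort (· ≥ ·)).length) :=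
  greedyTreeOfList (D.sort (· ≥ ·))

/-! ### Alternating greedy trees -/

/-- Vertices of the tree rooted at `none` whose root has children of degrees `c₁, …, c_k`. The `i`-th
child is `some ⟨i, 0⟩`, and the vertices `some ⟨i, l⟩` with `0 < l < c_i` are its children. -/
abbrev BranchVertex (cs : List ℕ) : Type := Option (Σ i : Fin cs.length, Fin (cs.get i))

/-- The tree rooted at `none` whose root has `cs.length` children, of degrees listed in `cs`; the
`i`-th child is the root's neighbour and has `cs[i] - 1` further neighbours, all of them leaves. -/
def branchTree (cs : List ℕ) : SimpleGraph (BranchVertex cs) :=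
  SimpleGraph.fromRel fun x y =>
    match x, y with
    | none, some ⟨_, l⟩ => (l : ℕ) = 0
    | some ⟨i, k⟩, some ⟨j, _⟩ => i = j ∧ (k : ℕ) = 0
    | _, none => False

/-- The graph obtained from disjoint copies of `S` and `T` by identifying the vertex `v` of `S` with
the vertex `none` of `T`; the merged vertex is called `Sum.inl v`. -/
def identify {V α : Type*} (S : SimpleGraph V) (v : V) (T : SimpleGraph (Option α)) :
    SimpleGraph (V ⊕ α) :=
  SimpleGraph.fromRel fun x y =>
    match x, y with
    | Sum.inl a, Sum.inl b => S.Adj a b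
    | Sum.inr x, Sum.inr y => T.Adj (some x) (some y)
    | Sum.inl a, Sum.inr y => a = v ∧ T.Adj none (some y)
    | Sum.inr _, Sum.inl _ => False

open scoped Classical in
/-- `v` is a leaf of `S` whose neighbour has the smallest degree among the neighbours of leaves. -/
def IsMinLeaf {V : Type*} [Fintype V] (S : SimpleGraph V) (v : V) : Prop :=
  S.degree v = 1 ∧ ∃ u, S.Adj v u ∧
    ∀ v' u', S.degree v' = 1 → S.Adj v' u' → S.degree u ≤ S.degree u'

/-- `AlternatingGreedyBuild d V G` says that `G` is one of the possible outputs of the recursive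
construction for the non-increasing list `d = (d₁, …, d_m)` of internal degrees. The last entry
`d_m` is called `k`. -/
inductive AlternatingGreedyBuild : List ℕ → (V : Type) → SimpleGraph V → Prop
  /-- If `m - 1 ≤ d_m`, the root has `d_m` children, of degrees `d₁, …, d_{m-1}, 1, …, 1`. -/
  | base (ds : List ℕ) (k : ℕ) (h : ds.length ≤ k) :
      AlternatingGreedyBuild (ds ++ [k]) (BranchVertex (ds ++ List.replicate (k - ds.length) 1))
        (branchTree (ds ++ List.replicate (k - ds.length) 1))
  /-- If `m - 1 ≥ d_m + 1`, let `ds` be the first `d_m - 1` entries of `d` and `es` the entries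
  between them and `d_m`. A tree `S` built from `es` is extended by identifying a leaf `v` of `S`
  whose neighbour has the smallest degree with the root of the tree whose root has children of
  degrees `ds`. -/
  | step (ds es : List ℕ) (k : ℕ) (hds : ds.length + 1 = k) (hk : k + 1 ≤ ds.length + es.length)
      (V : Type) [Fintype V] (S : SimpleGraph V) (hS : AlternatingGreedyBuild es V S)
      (v : V) (hv : IsMinLeaf S v) :
      AlternatingGreedyBuild (ds ++ es ++ [k])
        (V ⊕ (Σ i : Fin ds.length, Fin (ds.get i))) (identify S v (branchTree ds))

/-- The degrees of the internal vertices, that is, the entries greater than one, in non-increasing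
order. -/
def internalDegrees (D : Multiset ℕ) : List ℕ :=
  (D.filter fun k => 1 < k).sort (· ≥ ·)

/-- `G` is, up to isomorphism, an alternating greedy tree for the degree sequence `D`. -/
def IsAlternatingGreedyTree {V : Type*} (D : Multiset ℕ) (G : SimpleGraph V) : Prop :=
  ∃ (W : Type) (H : SimpleGraph W),
    AlternatingGreedyBuild (internalDegrees D) W H ∧ Nonempty (G ≃g H)

end SomborTrees

/-! The weight `√(x² + y²)` is submodular in `(x, y)`, because the square root is concave. Summing
its mixed differences (`layer_decomposition`) writes twice the Sombor index as a quantity depending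
only on the degree sequence, minus a combination with nonnegative coefficients of the counts
`highCount s t` (`sum_adj_eq_sub`). Hence a tree that maximizes every `highCount s t` at once among
trees with its degree sequence has minimal Sombor index, and one that minimizes them all has maximal
index (`somborIndex_le_of_highCount_le`). By symmetry `s ≤ t` suffices.

Upper bounds for `highCount s t` in a tree are the degree sum of the vertices of degree at least
`t`, and, if there are such vertices, the number of them plus the number of vertices of degree at
least `s`, minus 2 (`pairCount_le_of_subset`). The greedy tree is numbered with non-increasing
degrees and monotone parents, so for each `s ≤ t` it attains one of these
(`highCount_greedyTreeOfList`).

For the maximum, `highCount s t + mixedCount s t` is fixed by the degree sequence, so `mixedCount s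
t` must be maximized. Let `P`, `Q`, `R` be the vertices of degree at least `t`, below `s`, and in
between. The edges between `P` and `Q` number at most the degree sum of `P`, at most that of `Q`, at
most `|P| + |Q| - 1` when `P ∪ Q` is nonempty, and, if `R` is nonempty, at most what remains of the
`n - 1` edges of the tree after removing those that meet `R`. `AttainsMixedBound` says that one of
the four is an equality. It is proved along the recursion (`alternatingInvariant_base`,
`alternatingInvariant_step`), together with `LeafDichotomy`, which settles the thresholds `s` below
which there are only leaves and uses that the glued leaf has a neighbour of minimal degree. For
larger `s`, gluing either adds the same amount to `mixedCount` and to all four bounds, or makes the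
first bound sharp. -/

namespace SomborTrees
section
open scoped Classical
open Finset

/-! ### Counting adjacent pairs and vertices by class -/

/-- The degree of a vertex, as a sum of indicators. -/
noncomputable def deg {V : Type*} [Fintype V] (G : SimpleGraph V) (v : V) : ℕ :=
  ∑ w, if G.Adj v w then 1 else 0

/-- The number of ordered pairs of adjacent vertices, the first in `P` and the second in `Q`. -/
noncomputable def pairCount {V : Type*} [Fintype V] (G : SimpleGraph V) (P Q : V → Prop) : ℕ :=
  ∑ u, ∑ v, if G.Adj u v ∧ P u ∧ Q v then 1 else 0

/-- The number of vertices in `P`. -/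
noncomputable def vertexCount {V : Type*} [Fintype V] (P : V → Prop) : ℕ :=
  ∑ v, if P v then 1 else 0

/-- The sum of the degrees of the vertices in `P`. -/
noncomputable def degSum {V : Type*} [Fintype V] (G : SimpleGraph V) (P : V → Prop) : ℕ :=
  ∑ v, if P v then deg G v else 0

theorem degree_eq_deg {V : Type*} [Fintype V] (G : SimpleGraph V) (v : V)
    [Fintype (G.neighborSet v)] : G.degree v = deg G v := by
  rw [deg, ← SimpleGraph.card_neighborFinset_eq_degree, Finset.card_eq_sum_ones,
    ← Finset.sum_filter]
  apply Finset.sum_congr _ (fun _ _ => rfl)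
  ext w
  simp

theorem degreeSequence_eq_map_deg {V : Type*} [Fintype V] (G : SimpleGraph V) :
    degreeSequence G = (Finset.univ : Finset V).val.map (deg G) := by
  unfold degreeSequence
  simp only [degree_eq_deg]

theorem sum_comp_deg {V M : Type*} [Fintype V] [AddCommMonoid M] (G : SimpleGraph V) (g : ℕ → M) :
    ∑ v, g (deg G v) = ((degreeSequence G).map g).sum := by
  rw [degreeSequence_eq_map_deg, Multiset.map_map]
  rfl

theorem degSum_eq_sum {V : Type*} [Fintype V] (G : SimpleGraph V) (p : ℕ → Prop)
    [DecidablePred p] : degSum G (fun v => p (deg G v)) =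
      ∑ v, if p (deg G v) then deg G v else 0 := by
  unfold degSum
  congr!

theorem vertexCount_eq_sum {V : Type*} [Fintype V] (G : SimpleGraph V) (p : ℕ → Prop)
    [DecidablePred p] : vertexCount (fun v => p (deg G v)) =
      ∑ v, if p (deg G v) then 1 else 0 := by
  unfold vertexCount
  congr!

/-- Indicator functions recover multiplicities, so a formula for all sums over the vertices
determines the degree sequence. -/
theorem degreeSequence_eq_of_sum {V : Type*} [Fintype V] (G : SimpleGraph V) (D : Multiset ℕ)
    (h : ∀ g : ℕ → ℕ, ∑ v, g (deg G v) = (D.map g).sum) : degreeSequence G = D := by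
  ext k
  have h2 : ∀ E : Multiset ℕ, (E.map fun x => if k = x then 1 else 0).sum = E.count k := by
    intro E
    induction E using Multiset.induction with
    | empty => simp
    | cons a E ih =>
      rw [Multiset.map_cons, Multiset.sum_cons, ih, Multiset.count_cons]
      ring
  rw [← h2, ← h2, ← h]
  exact (sum_comp_deg G _).symm

theorem two_mul_somborIndex {V : Type*} [Fintype V] (G : SimpleGraph V) :
    2 * somborIndex G =
      ∑ u, ∑ v, if G.Adj u v then √((deg G u : ℝ) ^ 2 + (deg G v : ℝ) ^ 2) else 0 := by
  have h0 : ∀ F : Sym2 V → ℝ, 2 * ∑ e ∈ G.edgeFinset, F e =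
      ∑ u, ∑ v, if G.Adj u v then F s(u, v) else 0 := by
    intro F
    rw [← Fintype.sum_prod_type' (f := fun u v => if G.Adj u v then F s(u, v) else 0),
      ← Finset.sum_filter,
      ← Finset.sum_fiberwise_of_maps_to (t := G.edgeFinset) (g := fun p : V × V => s(p.1, p.2)),
      Finset.mul_sum]
    · refine Finset.sum_congr rfl fun e he => ?_
      induction e using Sym2.ind with
      | _ a b =>
        rw [SimpleGraph.mem_edgeFinset, SimpleGraph.mem_edgeSet] at he
        have : ({p ∈ ({p : V × V | G.Adj p.1 p.2} : Finset (V × V)) | s(p.1, p.2) = s(a, b)} :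
            Finset (V × V)) = {(a, b), (b, a)} := by
          ext ⟨x, y⟩
          simp only [Finset.mem_filter, Finset.mem_univ, true_and, Finset.mem_insert,
            Finset.mem_singleton, Sym2.eq_iff, Prod.mk.injEq]
          constructor
          · exact fun h => h.2
          · rintro (⟨rfl, rfl⟩ | ⟨rfl, rfl⟩)
            · exact ⟨he, by simp⟩
            · exact ⟨he.symm, by simp⟩
        rw [this, Finset.sum_pair (by intro h; exact he.ne (Prod.mk.inj h).1)]
        rw [Sym2.eq_swap (a := b)]
        ring
    · rintro ⟨x, y⟩ h
      simpa using h
  unfold somborIndex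
  rw [h0]
  refine Finset.sum_congr rfl fun u _ => Finset.sum_congr rfl fun v _ => ?_
  simp only [Sym2.lift_mk, degree_eq_deg]

theorem pairCount_comm {V : Type*} [Fintype V] (G : SimpleGraph V) (P Q : V → Prop) :
    pairCount G P Q = pairCount G Q P := by
  unfold pairCount
  rw [Finset.sum_comm]
  refine Finset.sum_congr rfl fun u _ => Finset.sum_congr rfl fun v _ => ?_
  simp only [G.adj_comm u v, and_comm (a := P v)]

theorem pairCount_congr {V : Type*} [Fintype V] (G : SimpleGraph V) {P Q P' Q' : V → Prop}
    (h : ∀ u v, G.Adj u v → (P u ∧ Q v ↔ P' u ∧ Q' v)) : pairCount G P Q = pairCount G P' Q' := by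
  unfold pairCount
  refine Finset.sum_congr rfl fun u _ => Finset.sum_congr rfl fun v _ => ?_
  exact if_congr (and_congr_right (h u v)) rfl rfl

theorem pairCount_mono {V : Type*} [Fintype V] (G : SimpleGraph V) {P Q P' Q' : V → Prop}
    (h : ∀ u v, G.Adj u v → P u → Q v → P' u ∧ Q' v) : pairCount G P Q ≤ pairCount G P' Q' := by
  unfold pairCount
  refine Finset.sum_le_sum fun u _ => Finset.sum_le_sum fun v _ => ?_
  by_cases hc : G.Adj u v ∧ P u ∧ Q v
  · rw [if_pos hc, if_pos ⟨hc.1, h u v hc.1 hc.2.1 hc.2.2⟩]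
  · rw [if_neg hc]; exact Nat.zero_le _

theorem pairCount_or_left {V : Type*} [Fintype V] (G : SimpleGraph V) {P P' : V → Prop}
    (Q : V → Prop) (h : ∀ u, P u → ¬ P' u) :
    pairCount G (fun u => P u ∨ P' u) Q = pairCount G P Q + pairCount G P' Q := by
  unfold pairCount
  simp only [← Finset.sum_add_distrib]
  refine Finset.sum_congr rfl fun u _ => Finset.sum_congr rfl fun v _ => ?_
  have := h u
  by_cases h1 : P u <;> by_cases h2 : P' u <;> simp_all

theorem pairCount_or_right {V : Type*} [Fintype V] (G : SimpleGraph V) {Q Q' : V → Prop}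
    (P : V → Prop) (h : ∀ u, Q u → ¬ Q' u) :
    pairCount G P (fun u => Q u ∨ Q' u) = pairCount G P Q + pairCount G P Q' := by
  rw [pairCount_comm, pairCount_or_left G P h, pairCount_comm G Q, pairCount_comm G Q']

theorem pairCount_true_right {V : Type*} [Fintype V] (G : SimpleGraph V) (P : V → Prop) :
    pairCount G P (fun _ => True) = degSum G P := by
  unfold pairCount degSum deg
  refine Finset.sum_congr rfl fun u _ => ?_
  by_cases h : P u <;> simp [h]

theorem pairCount_true_left {V : Type*} [Fintype V] (G : SimpleGraph V) (P : V → Prop) :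
    pairCount G (fun _ => True) P = degSum G P := by
  rw [pairCount_comm, pairCount_true_right]

theorem deg_eq_pairCount {V : Type*} [Fintype V] (G : SimpleGraph V) (v : V) :
    deg G v = pairCount G (fun u => u = v) (fun _ => True) := by
  rw [pairCount_true_right]; simp [degSum]

theorem pairCount_compl_right {V : Type*} [Fintype V] (G : SimpleGraph V) (P Q : V → Prop) :
    pairCount G P Q + pairCount G P (fun v => ¬ Q v) = degSum G P := by
  rw [← pairCount_or_right G P (fun _ h => not_not.mpr h), ← pairCount_true_right]
  exact pairCount_congr G fun u v _ => by simp [em]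

/-! ### Submodularity and reduction to threshold counts -/

/-- The mixed differences telescope in both variables. The sign is chosen so that the coefficients
are nonnegative for submodular `F`. -/
theorem layer_decomposition (F : ℕ → ℕ → ℝ) (N x y : ℕ) (hx : x ≤ N) (hy : y ≤ N) :
    F x y = F x 0 + F 0 y - F 0 0 - ∑ s ∈ range N, ∑ t ∈ range N,
      (F (s + 1) t + F s (t + 1) - F (s + 1) (t + 1) - F s t) *
        (if s + 1 ≤ x ∧ t + 1 ≤ y then 1 else 0) := by
  have restrict : ∀ (h : ℕ → ℝ) (x : ℕ), x ≤ N →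
      ∑ s ∈ range N, (if s + 1 ≤ x then h s else 0) = ∑ s ∈ range x, h s := by
    intro h x hx
    rw [← Finset.sum_filter]
    apply Finset.sum_congr _ (fun _ _ => rfl)
    ext s
    simp only [Finset.mem_filter, Finset.mem_range]
    omega
  have h1 : ∀ s, ∑ t ∈ range N, (F (s + 1) t + F s (t + 1) - F (s + 1) (t + 1) - F s t) *
        (if s + 1 ≤ x ∧ t + 1 ≤ y then 1 else 0) =
      if s + 1 ≤ x then (F (s + 1) 0 - F (s + 1) y) - (F s 0 - F s y) else 0 := by
    intro s
    by_cases hs : s + 1 ≤ x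
    · simp only [hs, true_and, mul_ite, mul_one, mul_zero, if_true]
      rw [restrict _ y hy]
      have := Finset.sum_range_sub' (fun t => F (s + 1) t - F s t) y
      rw [Finset.sum_congr rfl (fun t _ => (by ring : F (s + 1) t + F s (t + 1) -
        F (s + 1) (t + 1) - F s t = (F (s + 1) t - F s t) - (F (s + 1) (t + 1) - F s (t + 1)))),
        this]
      ring
    · simp [hs]
  rw [Finset.sum_congr rfl (fun s _ => h1 s), restrict _ x hx,
    Finset.sum_range_sub (fun s => F s 0 - F s y)]
  ring

theorem sqrt_submodular {a b c d : ℝ} (ha : 0 ≤ a) (hab : a ≤ b) (hc : 0 ≤ c) (hcd : c ≤ d) :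
    √(b + d) + √(a + c) ≤ √(b + c) + √(a + d) := by
  have h1 : (√(b + d) + √(a + c)) ^ 2 ≤ (√(b + c) + √(a + d)) ^ 2 := by
    -- Both sides have radicands with the same total, so after squaring only the cross terms differ;
    -- the products under the root differ by `(b - a) * (d - c)`.
    have h2 : √(b + d) * √(a + c) ≤ √(b + c) * √(a + d) := by
      rw [← Real.sqrt_mul (by linarith), ← Real.sqrt_mul (by linarith)]
      apply Real.sqrt_le_sqrt
      nlinarith [mul_nonneg (sub_nonneg.mpr hab) (sub_nonneg.mpr hcd)]
    rw [add_sq, add_sq, Real.sq_sqrt (by linarith), Real.sq_sqrt (by linarith),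
      Real.sq_sqrt (by linarith), Real.sq_sqrt (by linarith)]
    linarith
  exact le_of_sq_le_sq h1 (by positivity)

/-- The number of ordered pairs of adjacent vertices of degrees at least `s` and `t`. -/
noncomputable def highCount {V : Type*} [Fintype V] (G : SimpleGraph V) (s t : ℕ) : ℕ :=
  pairCount G (fun u => s ≤ deg G u) (fun v => t ≤ deg G v)

/-- Summing `layer_decomposition` over adjacent pairs turns the indicators into `highCount`, and the
boundary terms depend on one endpoint each, hence only on the degrees. -/
theorem sum_adj_eq_sub {V : Type*} [Fintype V] (G : SimpleGraph V) (F : ℕ → ℕ → ℝ) (N : ℕ)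
    (hN : ∀ v, deg G v ≤ N) :
    ∑ u, ∑ v, (if G.Adj u v then F (deg G u) (deg G v) else 0) =
      ∑ u, (deg G u : ℝ) * (F (deg G u) 0 + F 0 (deg G u) - F 0 0) -
      ∑ s ∈ range N, ∑ t ∈ range N,
        (F (s + 1) t + F s (t + 1) - F (s + 1) (t + 1) - F s t) *
          (highCount G (s + 1) (t + 1) : ℝ) := by
  have h1 : ∀ u v, (if G.Adj u v then F (deg G u) (deg G v) else 0) =
      (if G.Adj u v then F (deg G u) 0 - F 0 0 else 0) +
      (if G.Adj u v then F 0 (deg G v) else 0) -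
      ∑ s ∈ range N, ∑ t ∈ range N, (F (s + 1) t + F s (t + 1) - F (s + 1) (t + 1) - F s t) *
        (if G.Adj u v ∧ s + 1 ≤ deg G u ∧ t + 1 ≤ deg G v then 1 else 0) := by
    intro u v
    by_cases h : G.Adj u v
    · simp only [h, if_true, true_and]
      rw [layer_decomposition F N _ _ (hN u) (hN v)]
      ring
    · simp [h]
  have h2 : ∀ u (c : ℝ), ∑ v, (if G.Adj u v then c else 0) = deg G u * c := by
    intro u c
    rw [deg, Nat.cast_sum, Finset.sum_mul]
    refine Finset.sum_congr rfl fun v _ => ?_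
    by_cases h : G.Adj u v <;> simp [h]
  simp only [h1, Finset.sum_add_distrib, Finset.sum_sub_distrib]
  congr 1
  · rw [Finset.sum_comm (f := fun u v => if G.Adj u v then F 0 (deg G v) else 0)]
    simp only [G.adj_comm, h2]
    rw [← Finset.sum_add_distrib]
    refine Finset.sum_congr rfl fun u _ => ?_
    ring
  · have : ∀ s t, (highCount G s t : ℝ) = ∑ u, ∑ v,
        (if G.Adj u v ∧ s ≤ deg G u ∧ t ≤ deg G v then 1 else 0) := by
      intro s t
      simp [highCount, pairCount]
    simp only [this, Finset.mul_sum]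
    rw [Finset.sum_congr rfl fun u _ => Finset.sum_comm, Finset.sum_comm]
    refine Finset.sum_congr rfl fun s _ => ?_
    rw [Finset.sum_congr rfl fun u _ => Finset.sum_comm, Finset.sum_comm]

theorem somborIndex_le_of_highCount_le {V W : Type*} [Fintype V] [Fintype W] (G : SimpleGraph V)
    (H : SimpleGraph W) (hGH : degreeSequence G = degreeSequence H)
    (h : ∀ s t, s ≤ t → highCount H s t ≤ highCount G s t) : somborIndex G ≤ somborIndex H := by
  have h' : ∀ s t, highCount H s t ≤ highCount G s t := by
    intro s t
    rcases le_total s t with hst | hst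
    · exact h s t hst
    · have := h t s hst
      unfold highCount at this ⊢
      rwa [pairCount_comm H, pairCount_comm G]
  have hN : ∃ N, (∀ v, deg G v ≤ N) ∧ ∀ v, deg H v ≤ N := by
    refine ⟨∑ v, deg G v + ∑ v, deg H v, fun v => ?_, fun v => ?_⟩
    · exact (Finset.single_le_sum (f := deg G) (fun _ _ => Nat.zero_le _)
        (Finset.mem_univ v)).trans (Nat.le_add_right _ _)
    · exact (Finset.single_le_sum (f := deg H) (fun _ _ => Nat.zero_le _)
        (Finset.mem_univ v)).trans (Nat.le_add_left _ _)
  obtain ⟨N, hNG, hNH⟩ := hN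
  set F : ℕ → ℕ → ℝ := fun x y => √((x : ℝ) ^ 2 + (y : ℝ) ^ 2) with hF
  have eG := sum_adj_eq_sub G F N hNG
  have eH := sum_adj_eq_sub H F N hNH
  rw [← two_mul_somborIndex] at eG eH
  rw [sum_comp_deg G fun x => (x : ℝ) * (F x 0 + F 0 x - F 0 0)] at eG
  rw [sum_comp_deg H fun x => (x : ℝ) * (F x 0 + F 0 x - F 0 0), ← hGH] at eH
  have key : ∑ s ∈ range N, ∑ t ∈ range N,
        (F (s + 1) t + F s (t + 1) - F (s + 1) (t + 1) - F s t) *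
          (highCount H (s + 1) (t + 1) : ℝ) ≤ ∑ s ∈ range N, ∑ t ∈ range N,
        (F (s + 1) t + F s (t + 1) - F (s + 1) (t + 1) - F s t) *
          (highCount G (s + 1) (t + 1) : ℝ) := by
    refine Finset.sum_le_sum fun s _ => Finset.sum_le_sum fun t _ => ?_
    refine mul_le_mul_of_nonneg_left (by exact_mod_cast h' _ _) ?_
    have hm : ∀ n : ℕ, (n : ℝ) ^ 2 ≤ ((n + 1 : ℕ) : ℝ) ^ 2 := by
      intro n; gcongr; omega
    have := sqrt_submodular (sq_nonneg (s : ℝ)) (hm s) (sq_nonneg (t : ℝ)) (hm t)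
    simp only [hF]
    linarith
  linarith

/-! ### Edge bounds in trees and forests -/

theorem pairCount_true_true {V : Type*} [Fintype V] (G : SimpleGraph V) :
    pairCount G (fun _ => True) (fun _ => True) = ∑ u, deg G u := by
  rw [pairCount_true_right]; simp [degSum]

theorem sum_deg_eq_two_mul_card_edgeFinset {V : Type*} [Fintype V] (G : SimpleGraph V) :
    ∑ u, deg G u = 2 * G.edgeFinset.card := by
  rw [← G.sum_degrees_eq_twice_card_edges]
  simp only [degree_eq_deg]

theorem sum_deg_of_isTree {V : Type*} [Fintype V] {G : SimpleGraph V} (hG : G.IsTree) :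
    ∑ u, deg G u + 2 = 2 * Fintype.card V := by
  rw [sum_deg_eq_two_mul_card_edgeFinset, ← hG.card_edgeFinset]
  ring

theorem isTree_of_connected_of_sum_deg {V : Type*} [Fintype V] {G : SimpleGraph V}
    (hG : G.Connected) (h : ∑ u, deg G u + 2 = 2 * Fintype.card V) : G.IsTree := by
  rw [SimpleGraph.isTree_iff_connected_and_card]
  refine ⟨hG, ?_⟩
  rw [sum_deg_eq_two_mul_card_edgeFinset] at h
  rw [Nat.card_eq_fintype_card, Nat.card_eq_fintype_card, ← SimpleGraph.edgeFinset_card]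
  omega

theorem deg_pos_of_connected {V : Type*} [Fintype V] [Nontrivial V] {G : SimpleGraph V}
    (hG : G.Connected) (v : V) : 0 < deg G v := by
  rw [← degree_eq_deg]
  exact hG.preconnected.degree_pos_of_nontrivial v

theorem pairCount_self_of_isAcyclic {V : Type*} [Fintype V] {G : SimpleGraph V}
    (hG : G.IsAcyclic) (P : V → Prop) (hP : ∃ x, P x) :
    pairCount G P P + 2 ≤ 2 * vertexCount P := by
  obtain ⟨x₀, hx₀⟩ := hP
  have : Nonempty {x | P x} := ⟨⟨x₀, hx₀⟩⟩
  -- The induced forest on `P` extends to a tree on the vertex set `P`, which has `|P| - 1` edges.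
  obtain ⟨F, hF, -, hFT⟩ := SimpleGraph.Connected.exists_isTree_le_of_le_of_isAcyclic
    (SimpleGraph.connected_top (V := {x | P x})) le_top (hG.induce {x | P x})
  have hsub : ∀ f : V → ℕ, ∑ x : {x | P x}, f x = ∑ x, if P x then f x else 0 := by
    intro f
    rw [← Finset.sum_filter]
    exact (Finset.sum_subtype _ (by simp) f).symm
  have h1 : pairCount G P P = ∑ x, deg (G.induce {x | P x}) x := by
    refine Eq.trans ?_ (hsub fun x => ∑ y : {x | P x}, if G.Adj x y then 1 else 0).symm
    unfold pairCount
    refine Finset.sum_congr rfl fun x _ => ?_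
    rw [hsub fun y => if G.Adj x y then 1 else 0]
    by_cases h : P x
    · rw [if_pos h]
      refine Finset.sum_congr rfl fun y _ => ?_
      by_cases h' : P y <;> simp [h, h']
    · simp [h]
  have h2 : Fintype.card {x | P x} = vertexCount P := by
    rw [vertexCount, ← hsub fun _ => 1]
    simp
  have h3 := sum_deg_of_isTree hFT
  have h4 : ∑ x, deg (G.induce {x | P x}) x ≤ ∑ x, deg F x := by
    refine Finset.sum_le_sum fun x _ => Finset.sum_le_sum fun y _ => ?_
    by_cases h : (G.induce {x | P x}).Adj x y
    · rw [if_pos h, if_pos (hF h)]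
    · rw [if_neg h]; exact Nat.zero_le _
  omega

/-- The count for `(P, Q)` is at most the average of those for `(P, P)` and `(Q, Q)`: passing from
`(P, P)` to `(P, Q)` adds the pairs in `P × (Q \ P)`, and passing on to `(Q, Q)` adds at least as
many. -/
theorem pairCount_le_of_subset {V : Type*} [Fintype V] {G : SimpleGraph V}
    (hG : G.IsAcyclic) (P Q : V → Prop) (hP : ∃ x, P x) (hPQ : ∀ x, P x → Q x) :
    pairCount G P Q + 2 ≤ vertexCount P + vertexCount Q := by
  have h1 := pairCount_self_of_isAcyclic hG P hP
  have h2 := pairCount_self_of_isAcyclic hG Q (hP.imp hPQ)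
  have hsplit : ∀ R, pairCount G R Q = pairCount G R P + pairCount G R (fun x => Q x ∧ ¬ P x) := by
    intro R
    rw [← pairCount_or_right G R (fun x h h' => h'.2 h)]
    refine pairCount_congr G fun u v _ => ?_
    have := hPQ v
    tauto
  have h3 := hsplit P
  have h4 := hsplit Q
  rw [pairCount_comm G Q P] at h4
  have h5 : pairCount G P (fun x => Q x ∧ ¬ P x) ≤ pairCount G (fun x => Q x ∧ ¬ P x) Q := by
    rw [pairCount_comm]
    exact pairCount_mono G fun u v _ hu hv => ⟨hu, hPQ v hv⟩
  have h6 := pairCount_comm G Q (fun x => Q x ∧ ¬ P x)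
  omega

theorem pairCount_le_of_disjoint {V : Type*} [Fintype V] {G : SimpleGraph V}
    (hG : G.IsAcyclic) (P Q : V → Prop) (hP : ∃ x, P x ∨ Q x) (hPQ : ∀ x, P x → ¬ Q x) :
    pairCount G P Q + 1 ≤ vertexCount P + vertexCount Q := by
  have h1 := pairCount_self_of_isAcyclic hG _ hP
  rw [pairCount_or_left G _ hPQ, pairCount_or_right G _ hPQ, pairCount_or_right G _ hPQ,
    pairCount_comm G Q P] at h1
  have h2 : vertexCount (fun x => P x ∨ Q x) = vertexCount P + vertexCount Q := by
    unfold vertexCount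
    rw [← Finset.sum_add_distrib]
    refine Finset.sum_congr rfl fun x _ => ?_
    have := hPQ x
    by_cases hp : P x <;> by_cases hq : Q x <;> simp_all
  rw [h2] at h1
  omega

/-- Let `R` be the complement of `P ∪ Q`. At most `|R| - 1` edges lie inside `R`, so at least
`degSum R - (|R| - 1)` of the `n - 1` edges meet `R`, and none of these joins `P` to `Q`. -/
theorem pairCount_add_sum_le_of_disjoint {V : Type*} [Fintype V] {G : SimpleGraph V}
    (hG : G.IsTree) (P Q : V → Prop) (hR : ∃ x, ¬ P x ∧ ¬ Q x) (hPQ : ∀ x, P x → ¬ Q x) :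
    pairCount G P Q + degSum G (fun x => ¬ P x ∧ ¬ Q x) + 2 ≤
      Fintype.card V + vertexCount (fun x => ¬ P x ∧ ¬ Q x) := by
  have h1 := pairCount_self_of_isAcyclic hG.isAcyclic _ hR
  have h2 := sum_deg_of_isTree hG
  set R : V → Prop := fun x => ¬ P x ∧ ¬ Q x with hRdef
  have hsplit : ∀ S, degSum G S =
      pairCount G S R + (pairCount G S P + pairCount G S Q) := by
    intro S
    rw [← pairCount_or_right G S hPQ, ← pairCount_or_right G S (by intro x; simp only [hRdef]; tauto),
      ← pairCount_true_right]
    refine pairCount_congr G fun u v _ => ?_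
    simp only [hRdef]
    tauto
  have e0 := hsplit (fun _ => True)
  have eR := hsplit R
  have eP := hsplit P
  have eQ := hsplit Q
  simp only [pairCount_true_left] at e0
  have e1 : degSum G (fun _ => True) = ∑ x, deg G x := by simp [degSum]
  have c1 := pairCount_comm G Q P
  have c2 := pairCount_comm G R P
  have c3 := pairCount_comm G R Q
  omega

/-! ### Graphs given by a parent function -/

/-- The edges correspond to the non-root vertices through `x ↦ {p x, x}`, and each is counted in its
two orders. -/
theorem pairCount_of_parent {V : Type*} [Fintype V] {G : SimpleGraph V} {r : V} {p : V → V}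
    {ρ : V → ℕ} (hρ : ∀ x, x ≠ r → ρ (p x) < ρ x)
    (hadj : ∀ x y, G.Adj x y ↔ (y ≠ r ∧ p y = x) ∨ (x ≠ r ∧ p x = y)) (P Q : V → Prop) :
    pairCount G P Q = ∑ x, if x ≠ r then
      (if P (p x) ∧ Q x then 1 else 0) + (if P x ∧ Q (p x) then 1 else 0) else 0 := by
  have h1 : ∀ x y, (if G.Adj x y ∧ P x ∧ Q y then 1 else 0) =
      (if x = p y then (if y ≠ r ∧ P (p y) ∧ Q y then 1 else 0) else 0) +
      (if y = p x then (if x ≠ r ∧ P x ∧ Q (p x) then 1 else 0) else 0) := by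
    intro x y
    -- The decrease of `ρ` along parents rules out two vertices being each other's parent, so no
    -- ordered pair is counted twice.
    have h2 : ¬ ((y ≠ r ∧ p y = x) ∧ (x ≠ r ∧ p x = y)) := by
      rintro ⟨⟨h3, h4⟩, h5, h6⟩
      have h7 := hρ x h5
      have h8 := hρ y h3
      rw [h6] at h7
      rw [h4] at h8
      omega
    rw [hadj]
    by_cases ha : y ≠ r ∧ p y = x
    · have hb : ¬ (x ≠ r ∧ p x = y) := fun hb => h2 ⟨ha, hb⟩
      obtain ⟨h3, rfl⟩ := ha
      by_cases h4 : y = p (p y)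
      · have : p y = r := by
          by_contra h5
          exact hb ⟨h5, h4.symm⟩
        simp [h3, this]
      · simp [h3, h4]
    · by_cases hb : x ≠ r ∧ p x = y
      · obtain ⟨h3, rfl⟩ := hb
        by_cases h4 : x = p (p x)
        · have : p x = r := by
            by_contra h5
            exact ha ⟨h5, h4.symm⟩
          simp [h3, this]
        · simp [h3, h4]
      · have ha' : ¬ (y ≠ r ∧ x = p y) := fun h => ha ⟨h.1, h.2.symm⟩
        have hb' : ¬ (x ≠ r ∧ y = p x) := fun h => hb ⟨h.1, h.2.symm⟩
        split_ifs <;> first | rfl | (exfalso; tauto)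
  unfold pairCount
  simp only [h1, Finset.sum_add_distrib]
  rw [Finset.sum_comm]
  simp only [Finset.sum_ite_eq', Finset.mem_univ, if_true]
  rw [← Finset.sum_add_distrib]
  refine Finset.sum_congr rfl fun x _ => ?_
  by_cases h : x = r <;> simp [h]

theorem connected_of_parent {V : Type*} {G : SimpleGraph V} {r : V} {p : V → V}
    {ρ : V → ℕ} (hρ : ∀ x, x ≠ r → ρ (p x) < ρ x) (hadj : ∀ x, x ≠ r → G.Adj (p x) x) :
    G.Connected := by
  have h : ∀ n x, ρ x < n → G.Reachable r x := by
    intro n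
    induction n with
    | zero => intro x hx; omega
    | succ n ih =>
      intro x hx
      by_cases hxr : x = r
      · rw [hxr]
      · have := hρ x hxr
        exact (ih (p x) (by omega)).trans (hadj x hxr).reachable
  have : Nonempty V := ⟨r⟩
  exact ⟨fun x y => (h _ x (Nat.lt_succ_self _)).symm.trans (h _ y (Nat.lt_succ_self _))⟩

theorem isTree_of_parent {V : Type*} [Fintype V] {G : SimpleGraph V} {r : V} {p : V → V}
    {ρ : V → ℕ} (hρ : ∀ x, x ≠ r → ρ (p x) < ρ x)
    (hadj : ∀ x y, G.Adj x y ↔ (y ≠ r ∧ p y = x) ∨ (x ≠ r ∧ p x = y)) : G.IsTree := by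
  apply isTree_of_connected_of_sum_deg
  · exact connected_of_parent hρ fun x hx => (hadj _ _).mpr (Or.inl ⟨hx, rfl⟩)
  · rw [← pairCount_true_true, pairCount_of_parent hρ hadj]
    simp only [and_self, if_true]
    rw [← Finset.sum_erase_add _ _ (Finset.mem_univ r), Finset.sum_congr rfl (g := fun _ => 2)
      (fun x hx => if_pos (Finset.ne_of_mem_erase hx)), Finset.sum_const,
      Finset.card_erase_of_mem (Finset.mem_univ r), Finset.card_univ]
    have : 0 < Fintype.card V := Fintype.card_pos_iff.mpr ⟨r⟩
    simp only [smul_eq_mul, ne_eq, not_true_eq_false, if_false]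
    omega

/-! ### Optimality criteria through sharp bounds -/

section
variable {V W : Type*} [Fintype V] [Fintype W] {G : SimpleGraph V} {H : SimpleGraph W}

theorem degSum_eq_of_degreeSequence_eq (h : degreeSequence G = degreeSequence H) (p : ℕ → Prop) :
    degSum G (fun v => p (deg G v)) = degSum H (fun v => p (deg H v)) := by
  unfold degSum
  rw [sum_comp_deg G (fun k => if p k then k else 0),
    sum_comp_deg H (fun k => if p k then k else 0), h]

theorem vertexCount_eq_of_degreeSequence_eq (h : degreeSequence G = degreeSequence H)
    (p : ℕ → Prop) : vertexCount (fun v => p (deg G v)) = vertexCount (fun v => p (deg H v)) := by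
  unfold vertexCount
  rw [sum_comp_deg G (fun k => if p k then 1 else 0),
    sum_comp_deg H (fun k => if p k then 1 else 0), h]

theorem card_degreeSequence (G : SimpleGraph V) :
    (degreeSequence G).card = Fintype.card V := by
  simp [degreeSequence]

theorem card_eq_of_degreeSequence_eq (h : degreeSequence G = degreeSequence H) :
    Fintype.card V = Fintype.card W := by
  rw [← card_degreeSequence G, h, card_degreeSequence]

theorem mem_degreeSequence {G : SimpleGraph V} {k : ℕ} :
    k ∈ degreeSequence G ↔ ∃ v, deg G v = k := by
  simp [degreeSequence_eq_map_deg]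

theorem exists_deg_of_degreeSequence_eq (h : degreeSequence G = degreeSequence H) {p : ℕ → Prop}
    (hp : ∃ v, p (deg G v)) : ∃ v, p (deg H v) := by
  obtain ⟨v, hv⟩ := hp
  obtain ⟨w, hw⟩ := mem_degreeSequence.mp (h ▸ mem_degreeSequence.mpr ⟨v, rfl⟩)
  exact ⟨w, hw ▸ hv⟩

/-- The number of edges from vertices of degree at least `t` to vertices of degree less than `s`. -/
noncomputable def mixedCount (G : SimpleGraph V) (s t : ℕ) : ℕ :=
  pairCount G (fun u => t ≤ deg G u) (fun v => deg G v < s)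

/-- `mixedCount G s t` equals one of four quantities that depend on the degree sequence only, each
of which is an upper bound for it in every tree. -/
def AttainsMixedBound (G : SimpleGraph V) (s t : ℕ) : Prop :=
  mixedCount G s t = degSum G (fun u => t ≤ deg G u) ∨
  mixedCount G s t = degSum G (fun u => deg G u < s) ∨
  mixedCount G s t + 1 = vertexCount (fun u => t ≤ deg G u) + vertexCount (fun u => deg G u < s) ∨
  (∃ u, ¬ t ≤ deg G u ∧ ¬ deg G u < s) ∧
    mixedCount G s t + degSum G (fun u => ¬ t ≤ deg G u ∧ ¬ deg G u < s) + 2 =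
      Fintype.card V + vertexCount (fun u => ¬ t ≤ deg G u ∧ ¬ deg G u < s)

theorem pairCount_le_degSum_left (G : SimpleGraph V) (P Q : V → Prop) :
    pairCount G P Q ≤ degSum G P := by
  rw [← pairCount_true_right]
  exact pairCount_mono G fun u v _ hu _ => ⟨hu, trivial⟩

theorem pairCount_le_degSum_right (G : SimpleGraph V) (P Q : V → Prop) :
    pairCount G P Q ≤ degSum G Q := by
  rw [pairCount_comm]
  exact pairCount_le_degSum_left G Q P

theorem highCount_add_mixedCount (G : SimpleGraph V) (s t : ℕ) :
    highCount G s t + mixedCount G s t = degSum G (fun v => t ≤ deg G v) := by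
  rw [← pairCount_compl_right G _ (fun v => s ≤ deg G v), highCount, pairCount_comm]
  simp only [mixedCount, not_le]

/-- The bound that `G` attains depends only on the degree sequence, so it equally bounds the count
in the tree `H`. -/
theorem mixedCount_le_of_attainsMixedBound (hGH : degreeSequence G = degreeSequence H)
    (hH : H.IsTree) {s t : ℕ} (hst : s ≤ t) (hG : AttainsMixedBound G s t) :
    mixedCount H s t ≤ mixedCount G s t := by
  have hdisj : ∀ x, t ≤ deg H x → ¬ deg H x < s := fun x h h' => by omega
  rcases hG with h | h | h | ⟨h0, h⟩
  · rw [h, degSum_eq_of_degreeSequence_eq hGH (fun k => t ≤ k)]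
    exact pairCount_le_degSum_left _ _ _
  · rw [h, degSum_eq_of_degreeSequence_eq hGH (fun k => k < s)]
    exact pairCount_le_degSum_right _ _ _
  · rw [vertexCount_eq_of_degreeSequence_eq hGH (fun k => t ≤ k),
      vertexCount_eq_of_degreeSequence_eq hGH (fun k => k < s)] at h
    -- If both classes were empty, `h` would say that a successor is zero.
    have hex : ∃ x, t ≤ deg H x ∨ deg H x < s := by
      by_contra hne
      push Not at hne
      have h1 : vertexCount (fun v => t ≤ deg H v) = 0 := by
        simpa [vertexCount] using fun x => (hne x).1
      have h2 : vertexCount (fun v => deg H v < s) = 0 := by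
        simpa [vertexCount] using fun x => (hne x).2
      omega
    have := pairCount_le_of_disjoint hH.isAcyclic _ _ hex hdisj
    unfold mixedCount at h ⊢
    omega
  · rw [vertexCount_eq_of_degreeSequence_eq hGH (fun k => ¬ t ≤ k ∧ ¬ k < s),
      degSum_eq_of_degreeSequence_eq hGH (fun k => ¬ t ≤ k ∧ ¬ k < s),
      card_eq_of_degreeSequence_eq hGH] at h
    have hex := exists_deg_of_degreeSequence_eq (p := fun k => ¬ t ≤ k ∧ ¬ k < s) hGH h0
    have := pairCount_add_sum_le_of_disjoint hH _ _ hex hdisj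
    unfold mixedCount at h ⊢
    omega

theorem somborIndex_le_of_attainsMixedBound (hGH : degreeSequence G = degreeSequence H)
    (hH : H.IsTree) (hG : ∀ s t, s ≤ t → AttainsMixedBound G s t) :
    somborIndex H ≤ somborIndex G := by
  refine somborIndex_le_of_highCount_le H G hGH.symm fun s t hst => ?_
  have h1 := mixedCount_le_of_attainsMixedBound hGH hH hst (hG s t hst)
  have h2 := degSum_eq_of_degreeSequence_eq hGH (fun k => t ≤ k)
  have h3 := highCount_add_mixedCount G s t
  have h4 := highCount_add_mixedCount H s t
  omega

theorem somborIndex_le_of_highCount (hGH : degreeSequence G = degreeSequence H)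
    (hH : H.IsTree) (hG : ∀ s t, s ≤ t → highCount G s t = degSum G (fun v => t ≤ deg G v) ∨
      vertexCount (fun v => t ≤ deg G v) + vertexCount (fun v => s ≤ deg G v) ≤
        highCount G s t + 2) :
    somborIndex G ≤ somborIndex H := by
  refine somborIndex_le_of_highCount_le G H hGH fun s t hst => ?_
  rcases hG s t hst with h | h
  · rw [h, degSum_eq_of_degreeSequence_eq hGH (fun k => t ≤ k)]
    exact pairCount_le_degSum_right _ _ _
  · rw [vertexCount_eq_of_degreeSequence_eq hGH (fun k => t ≤ k),
      vertexCount_eq_of_degreeSequence_eq hGH (fun k => s ≤ k)] at h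
    by_cases hex : ∃ x, t ≤ deg H x
    · have := pairCount_le_of_subset hH.isAcyclic (fun x => t ≤ deg H x)
        (fun x => s ≤ deg H x) hex (fun x hx => hst.trans hx)
      rw [pairCount_comm] at this
      unfold highCount at h ⊢
      omega
    · have h0 : highCount H s t ≤ degSum H (fun v => t ≤ deg H v) := pairCount_le_degSum_right _ _ _
      have h1 : degSum H (fun v => t ≤ deg H v) = 0 := by
        unfold degSum
        exact Finset.sum_eq_zero fun x _ => if_neg fun hx => hex ⟨x, hx⟩
      omega

/-! ### Invariance under isomorphism -/

theorem deg_iso (e : G ≃g H) (v : V) : deg H (e v) = deg G v := by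
  unfold deg
  rw [← e.toEquiv.sum_comp]
  refine Finset.sum_congr rfl fun w _ => ?_
  exact if_congr e.map_rel_iff rfl rfl

theorem degreeSequence_iso (e : G ≃g H) : degreeSequence G = degreeSequence H := by
  refine degreeSequence_eq_of_sum G _ fun g => ?_
  rw [← sum_comp_deg, ← e.toEquiv.sum_comp]
  exact Finset.sum_congr rfl fun v _ => congrArg g (deg_iso e v).symm

theorem somborIndex_iso (e : G ≃g H) : somborIndex G = somborIndex H := by
  have h : 2 * somborIndex G = 2 * somborIndex H := by
    rw [two_mul_somborIndex, two_mul_somborIndex, ← e.toEquiv.sum_comp]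
    refine Finset.sum_congr rfl fun u _ => ?_
    rw [← e.toEquiv.sum_comp]
    refine Finset.sum_congr rfl fun v _ => ?_
    have h1 := deg_iso e u
    have h2 := deg_iso e v
    change deg H (e.toEquiv u) = _ at h1
    change deg H (e.toEquiv v) = _ at h2
    rw [h1, h2]
    exact if_congr e.map_rel_iff.symm rfl rfl
  linarith

end

/-! ### The pieces of alternating greedy trees -/

theorem sum_fin_zero_or {n : ℕ} (hn : 0 < n) (a b : ℕ) :
    ∑ l : Fin n, (if (l : ℕ) = 0 then a else b) = a + (n - 1) * b := by
  obtain ⟨m, rfl⟩ := Nat.exists_eq_succ_of_ne_zero hn.ne'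
  rw [Fin.sum_univ_succ]
  simp

section BranchTree
variable {cs : List ℕ}

@[simp] theorem branchTree_adj_none_some (i : Fin cs.length) (l : Fin (cs.get i)) :
    (branchTree cs).Adj none (some ⟨i, l⟩) ↔ (l : ℕ) = 0 := by
  simp [branchTree]

@[simp] theorem branchTree_adj_some_none (i : Fin cs.length) (l : Fin (cs.get i)) :
    (branchTree cs).Adj (some ⟨i, l⟩) none ↔ (l : ℕ) = 0 := by
  simp [branchTree]

@[simp] theorem branchTree_adj_some_same (i : Fin cs.length) (k l : Fin (cs.get i)) :
    (branchTree cs).Adj (some ⟨i, k⟩) (some ⟨i, l⟩) ↔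
      k ≠ l ∧ ((k : ℕ) = 0 ∨ (l : ℕ) = 0) := by
  simp [branchTree]

theorem branchTree_not_adj_of_ne {i j : Fin cs.length} (hij : i ≠ j) (k : Fin (cs.get i))
    (l : Fin (cs.get j)) : ¬ (branchTree cs).Adj (some ⟨i, k⟩) (some ⟨j, l⟩) := by
  simp [branchTree, hij, hij.symm]

/-- The parent of a vertex of `branchTree cs`; the root is its own parent. -/
def branchParent (h : ∀ i, 0 < cs.get i) : BranchVertex cs → BranchVertex cs
  | none => none
  | some ⟨i, l⟩ => if (l : ℕ) = 0 then none else some ⟨i, ⟨0, h i⟩⟩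

/-- The distance of a vertex of `branchTree cs` from the root. -/
def branchDepth : BranchVertex cs → ℕ
  | none => 0
  | some ⟨_, l⟩ => if (l : ℕ) = 0 then 1 else 2

theorem branchDepth_branchParent (h : ∀ i, 0 < cs.get i) (x : BranchVertex cs) (hx : x ≠ none) :
    branchDepth (branchParent h x) < branchDepth x := by
  rcases x with _ | ⟨i, l⟩
  · exact absurd rfl hx
  · by_cases hl : (l : ℕ) = 0 <;> simp [branchParent, branchDepth, hl]

theorem branchTree_adj_iff_branchParent (h : ∀ i, 0 < cs.get i) (x y : BranchVertex cs) :
    (branchTree cs).Adj x y ↔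
      (y ≠ none ∧ branchParent h y = x) ∨ (x ≠ none ∧ branchParent h x = y) := by
  rcases x with _ | ⟨i, k⟩ <;> rcases y with _ | ⟨j, l⟩
  · simp
  · by_cases hl : (l : ℕ) = 0 <;> simp [branchParent, hl]
  · by_cases hl : (k : ℕ) = 0 <;> simp [branchParent, hl]
  · by_cases hij : i = j
    · subst hij
      rw [branchTree_adj_some_same]
      by_cases hl : (l : ℕ) = 0 <;> by_cases hk : (k : ℕ) = 0 <;>
        simp [branchParent, hl, hk, Fin.ext_iff, eq_comm]
    · simp only [branchTree_not_adj_of_ne hij, false_iff]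
      by_cases hl : (l : ℕ) = 0 <;> by_cases hk : (k : ℕ) = 0 <;>
        simp [branchParent, hl, hk, hij, Ne.symm hij]

theorem branchTree_isTree (h : ∀ i, 0 < cs.get i) : (branchTree cs).IsTree :=
  isTree_of_parent (branchDepth_branchParent h) (branchTree_adj_iff_branchParent h)

theorem deg_branchTree_none (h : ∀ i, 0 < cs.get i) :
    deg (branchTree cs) none = cs.length := by
  unfold deg
  rw [Fintype.sum_option, Fintype.sum_sigma]
  simp only [SimpleGraph.irrefl, if_false, branchTree_adj_none_some]
  rw [Finset.sum_congr rfl fun i _ => sum_fin_zero_or (h i) 1 0]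
  simp

theorem deg_branchTree_some (i : Fin cs.length) (l : Fin (cs.get i)) :
    deg (branchTree cs) (some ⟨i, l⟩) = if (l : ℕ) = 0 then cs.get i else 1 := by
  unfold deg
  rw [Fintype.sum_option, Fintype.sum_sigma, Finset.sum_eq_single i]
  · simp only [branchTree_adj_some_none, branchTree_adj_some_same]
    have hpos : 0 < cs.get i := Fin.pos l
    by_cases hl : (l : ℕ) = 0
    · have h1 : ∀ k : Fin (cs.get i), (if l ≠ k ∧ ((l : ℕ) = 0 ∨ (k : ℕ) = 0) then 1 else 0) =
          if (k : ℕ) = 0 then 0 else 1 := by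
        intro k
        by_cases hk : (k : ℕ) = 0 <;> simp [hl, hk, Fin.ext_iff, eq_comm]
      rw [Finset.sum_congr rfl fun k _ => h1 k, sum_fin_zero_or hpos]
      simp only [hl, if_true]
      omega
    · have h1 : ∀ k : Fin (cs.get i), (if l ≠ k ∧ ((l : ℕ) = 0 ∨ (k : ℕ) = 0) then 1 else 0) =
          if (k : ℕ) = 0 then 1 else 0 := by
        intro k
        by_cases hk : (k : ℕ) = 0 <;> simp [hl, hk, Fin.ext_iff]
      rw [Finset.sum_congr rfl fun k _ => h1 k, sum_fin_zero_or hpos]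
      simp [hl]
  · intro j _ hj
    simp [branchTree_not_adj_of_ne hj.symm]
  · simp

theorem sum_sigma_ite_zero (h : ∀ i, 0 < cs.get i) (a : Fin cs.length → ℕ) (b : ℕ) :
    ∑ x : (Σ i : Fin cs.length, Fin (cs.get i)), (if (x.2 : ℕ) = 0 then a x.1 else b) =
      ∑ i, (a i + (cs.get i - 1) * b) := by
  rw [Fintype.sum_sigma]
  exact Finset.sum_congr rfl fun i _ => sum_fin_zero_or (h i) (a i) b

theorem sum_deg_branchTree_some (h : ∀ i, 0 < cs.get i) (g : ℕ → ℕ) :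
    ∑ x : (Σ i : Fin cs.length, Fin (cs.get i)), g (deg (branchTree cs) (some x)) =
      ∑ i, (g (cs.get i) + (cs.get i - 1) * g 1) := by
  rw [← sum_sigma_ite_zero h]
  refine Finset.sum_congr rfl fun x _ => ?_
  rcases x with ⟨i, l⟩
  rw [deg_branchTree_some]
  by_cases hl : (l : ℕ) = 0 <;> simp [hl]

/-- With `P` confined to children of the root and `Q` containing every grandchild, a child in `P` is
paired with all its own children, and with the root exactly when the root is in `Q`. -/
theorem pairCount_branchTree (h : ∀ i, 0 < cs.get i) (P Q : BranchVertex cs → Prop)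
    (hP : ¬ P none) (hPl : ∀ i (l : Fin (cs.get i)), (l : ℕ) ≠ 0 → ¬ P (some ⟨i, l⟩))
    (hQl : ∀ i (l : Fin (cs.get i)), (l : ℕ) ≠ 0 → Q (some ⟨i, l⟩)) :
    pairCount (branchTree cs) P Q = ∑ i, if P (some ⟨i, ⟨0, h i⟩⟩) then
      (if Q none then 1 else 0) + (cs.get i - 1) else 0 := by
  rw [pairCount_of_parent (branchDepth_branchParent h) (branchTree_adj_iff_branchParent h),
    Fintype.sum_option, Fintype.sum_sigma]
  simp only [ne_eq, not_true_eq_false, if_false, zero_add, reduceCtorEq, not_false_eq_true, if_true]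
  refine Finset.sum_congr rfl fun i _ => ?_
  have h1 : ∀ l : Fin (cs.get i),
      ((if P (branchParent h (some ⟨i, l⟩)) ∧ Q (some ⟨i, l⟩) then 1 else 0) +
        if P (some ⟨i, l⟩) ∧ Q (branchParent h (some ⟨i, l⟩)) then 1 else 0) =
      if (l : ℕ) = 0 then (if P (some ⟨i, ⟨0, h i⟩⟩) ∧ Q none then 1 else 0)
        else if P (some ⟨i, ⟨0, h i⟩⟩) then 1 else 0 := by
    intro l
    by_cases hl : (l : ℕ) = 0
    · have : l = ⟨0, h i⟩ := Fin.ext hl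
      subst this
      simp [branchParent, hP]
    · simp [branchParent, hl, hPl i l hl, hQl i l hl]
  rw [Finset.sum_congr rfl fun l _ => h1 l, sum_fin_zero_or (h i)]
  by_cases hp : P (some ⟨i, ⟨0, h i⟩⟩) <;> simp only [hp, true_and, false_and, if_true, if_false,
    mul_one, mul_zero, add_zero]

end BranchTree

section Identify
variable {V α : Type*} {S : SimpleGraph V} {v : V} {T : SimpleGraph (Option α)}

@[simp] theorem identify_adj_inl_inl (a b : V) :
    (identify S v T).Adj (Sum.inl a) (Sum.inl b) ↔ S.Adj a b := by
  simp only [identify, SimpleGraph.fromRel_adj, S.adj_comm b a, or_self, ne_eq, Sum.inl.injEq,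
    and_iff_right_iff_imp]
  exact fun h => h.ne

@[simp] theorem identify_adj_inl_inr (a : V) (y : α) :
    (identify S v T).Adj (Sum.inl a) (Sum.inr y) ↔ a = v ∧ T.Adj none (some y) := by
  simp [identify]

@[simp] theorem identify_adj_inr_inl (a : V) (y : α) :
    (identify S v T).Adj (Sum.inr y) (Sum.inl a) ↔ a = v ∧ T.Adj none (some y) := by
  simp [identify]

@[simp] theorem identify_adj_inr_inr (x y : α) :
    (identify S v T).Adj (Sum.inr x) (Sum.inr y) ↔ T.Adj (some x) (some y) := by
  simp only [identify, SimpleGraph.fromRel_adj, T.adj_comm (some y) (some x), or_self, ne_eq,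
    Sum.inr.injEq, and_iff_right_iff_imp]
  exact fun h h' => h.ne (congrArg some h')

theorem identify_connected (hS : S.Connected) (hT : T.Connected) :
    (identify S v T).Connected := by
  let f : S →g identify S v T := ⟨Sum.inl, fun h => (identify_adj_inl_inl _ _).mpr h⟩
  let g : T →g identify S v T := ⟨fun x => x.elim (Sum.inl v) Sum.inr, by
    intro a b h
    rcases a with _ | a <;> rcases b with _ | b
    · exact absurd h T.irrefl
    · exact (identify_adj_inl_inr _ _).mpr ⟨rfl, h⟩
    · exact (identify_adj_inr_inl _ _).mpr ⟨rfl, h.symm⟩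
    · exact (identify_adj_inr_inr _ _).mpr h⟩
  have key : ∀ x, (identify S v T).Reachable (Sum.inl v) x := by
    rintro (a | y)
    · exact (hS.preconnected v a).map f
    · exact (hT.preconnected none (some y)).map g
  have : Nonempty (V ⊕ α) := ⟨Sum.inl v⟩
  exact ⟨fun x y => (key x).symm.trans (key y)⟩

variable [Fintype V] [Fintype α]

theorem deg_identify_inl (a : V) :
    deg (identify S v T) (Sum.inl a) = deg S a + if a = v then deg T none else 0 := by
  unfold deg
  rw [Fintype.sum_sum_type, Fintype.sum_option]
  simp only [identify_adj_inl_inl, identify_adj_inl_inr, SimpleGraph.irrefl, if_false]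
  by_cases h : a = v <;> simp [h]

theorem deg_identify_inr (y : α) :
    deg (identify S v T) (Sum.inr y) = deg T (some y) := by
  unfold deg
  rw [Fintype.sum_sum_type, Fintype.sum_option]
  simp only [identify_adj_inr_inl, identify_adj_inr_inr, T.adj_comm (some y) none]
  congr 1
  by_cases h : T.Adj none (some y) <;> simp [h]

/-- Gluing at a vertex makes the edge set a disjoint union of those of `S` and `T`, so counts add
once the predicates are pulled back. -/
theorem pairCount_identify (P Q : V ⊕ α → Prop) :
    pairCount (identify S v T) P Q =
      pairCount S (fun a => P (Sum.inl a)) (fun a => Q (Sum.inl a)) +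
      pairCount T (fun x => P (x.elim (Sum.inl v) Sum.inr))
        (fun x => Q (x.elim (Sum.inl v) Sum.inr)) := by
  have h1 : ∑ a, ∑ y, (if (a = v ∧ T.Adj none (some y)) ∧ P (Sum.inl a) ∧ Q (Sum.inr y) then 1
      else 0) = ∑ y, if T.Adj none (some y) ∧ P (Sum.inl v) ∧ Q (Sum.inr y) then 1 else 0 := by
    rw [Finset.sum_eq_single v]
    · simp
    · intro a _ ha
      simp [ha]
    · simp
  have h2 : ∑ y, ∑ a, (if (a = v ∧ T.Adj none (some y)) ∧ P (Sum.inr y) ∧ Q (Sum.inl a) then 1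
      else 0) = ∑ y, if T.Adj none (some y) ∧ P (Sum.inr y) ∧ Q (Sum.inl v) then 1 else 0 := by
    refine Finset.sum_congr rfl fun y _ => ?_
    rw [Finset.sum_eq_single v]
    · simp
    · intro a _ ha
      simp [ha]
    · simp
  unfold pairCount
  simp only [Fintype.sum_sum_type, Fintype.sum_option, Finset.sum_add_distrib,
    identify_adj_inl_inl, identify_adj_inl_inr, identify_adj_inr_inl, identify_adj_inr_inr,
    SimpleGraph.irrefl, false_and, if_false, Option.elim_none, Option.elim_some, h1, h2,
    T.adj_comm _ none]
  ring_nf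
  congr!

end Identify

/-! ### Alternating greedy trees attain the bounds -/

/-- The neighbours of leaves all have degree at least `t`, or every vertex of degree at least `t`
has exactly one neighbour that is not a leaf (expressed by counting). -/
def LeafDichotomy {V : Type*} [Fintype V] (G : SimpleGraph V) (t : ℕ) : Prop :=
  (∀ x y, G.Adj x y → deg G x = 1 → t ≤ deg G y) ∨
    pairCount G (fun u => t ≤ deg G u) (fun v => deg G v = 1) +
      vertexCount (fun u => t ≤ deg G u) = degSum G (fun u => t ≤ deg G u)

/-- The properties of alternating greedy trees that are proved along the recursion. -/
structure AlternatingInvariant (d : List ℕ) {V : Type*} [Fintype V] (G : SimpleGraph V) : Prop where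
  isTree : G.IsTree
  degreeSequence_eq : ∃ L, 0 < L ∧ degreeSequence G = (d : Multiset ℕ) + Multiset.replicate L 1
  two_le_of_leaf : ∀ x y, G.Adj x y → deg G x = 1 → 2 ≤ deg G y
  leafDichotomy : ∀ t, LeafDichotomy G t
  attains : ∀ s t, s ≤ t → AttainsMixedBound G s t

section
variable {V : Type*} [Fintype V] {G : SimpleGraph V}

/-- Vertices of degree below `s` then have degree 0, so the second bound is zero. -/
theorem attainsMixedBound_of_le_one {s : ℕ} (t : ℕ) (hs : s ≤ 1) : AttainsMixedBound G s t := by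
  have h1 : degSum G (fun u => deg G u < s) = 0 :=
    Finset.sum_eq_zero fun x _ => by
      split_ifs <;> omega
  have h2 : mixedCount G s t ≤ _ := pairCount_le_degSum_right _ _ _
  right; left
  omega

/-- Here the low class consists of the leaves. If all leaf edges end in degree at least `t`, the
second bound is sharp. Otherwise the count is the degree sum of the high class minus its size, and
with total degree `2n - 2` this is the fourth bound. If the middle class is empty, the first case
applies again, since no leaf is adjacent to a leaf. -/
theorem attainsMixedBound_of_leafDichotomy {s t : ℕ} (hst : s ≤ t)
    (hG : ∑ u, deg G u + 2 = 2 * Fintype.card V) (hs : ∀ x, deg G x < s ↔ deg G x = 1)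
    (hleaf : ∀ x y, G.Adj x y → deg G x = 1 → 2 ≤ deg G y) (h : LeafDichotomy G t) :
    AttainsMixedBound G s t := by
  have hall : (∀ x y, G.Adj x y → deg G x = 1 → t ≤ deg G y) → AttainsMixedBound G s t := by
    intro h
    right; left
    rw [← pairCount_true_left, mixedCount]
    refine pairCount_congr G fun u v huv => ?_
    rw [hs]
    exact ⟨fun h' => ⟨trivial, h'.2⟩, fun h' => ⟨h v u huv.symm h'.2, h'.2⟩⟩
  rcases h with h | h
  · exact hall h
  · by_cases hR : ∃ u, ¬ t ≤ deg G u ∧ ¬ deg G u < s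
    · right; right; right
      refine ⟨hR, ?_⟩
      have h1 : mixedCount G s t =
          pairCount G (fun u => t ≤ deg G u) (fun v => deg G v = 1) := by
        simp only [mixedCount, hs]
      have h2 : ∑ u, deg G u = degSum G (fun u => t ≤ deg G u) + vertexCount (fun u => deg G u < s)
          + degSum G (fun u => ¬ t ≤ deg G u ∧ ¬ deg G u < s) := by
        simp only [degSum, vertexCount, ← Finset.sum_add_distrib]
        refine Finset.sum_congr rfl fun x _ => ?_
        have := hs x
        split_ifs <;> omega
      have h3 : Fintype.card V = vertexCount (fun u => t ≤ deg G u) +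
          vertexCount (fun u => deg G u < s)
          + vertexCount (fun u => ¬ t ≤ deg G u ∧ ¬ deg G u < s) := by
        rw [← Finset.card_univ, Finset.card_eq_sum_ones]
        simp only [vertexCount, ← Finset.sum_add_distrib]
        refine Finset.sum_congr rfl fun x _ => ?_
        have := hs x
        split_ifs <;> omega
      omega
    · push Not at hR
      refine hall fun x y hxy hx => ?_
      have h1 := hleaf x y hxy hx
      by_contra h2
      have h3 := (hs y).mp (hR y (by omega))
      omega

end

theorem AlternatingInvariant.deg_eq {d : List ℕ} {V : Type*} [Fintype V] {G : SimpleGraph V}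
    (h : AlternatingInvariant d G) (x : V) : deg G x ∈ d ∨ deg G x = 1 := by
  obtain ⟨L, -, hL⟩ := h.degreeSequence_eq
  have := mem_degreeSequence.mpr ⟨x, (rfl : deg G x = deg G x)⟩
  rw [hL, Multiset.mem_add] at this
  exact this.imp Multiset.mem_coe.mp Multiset.eq_of_mem_replicate

theorem sum_get (ds : List ℕ) (g : ℕ → ℕ) : ∑ i, g (ds.get i) = (ds.map g).sum := by
  rw [← List.sum_ofFn]
  congr 1
  exact List.ext_get (by simp) (by simp)

theorem sum_get_sub_one (ds : List ℕ) (hds : ∀ i, 0 < ds.get i) (g : ℕ → ℕ) :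
    ∑ i, (ds.get i - 1) * g 1 + ds.length * g 1 = ds.sum * g 1 := by
  have h := sum_get ds id
  rw [List.map_id] at h
  rw [← h, ← Finset.sum_mul, ← add_mul]
  congr 1
  have h2 : ∑ _i : Fin ds.length, 1 = ds.length := by simp
  refine (congrArg _ h2.symm).trans ?_
  rw [← Finset.sum_add_distrib]
  refine Finset.sum_congr rfl fun i _ => ?_
  have := hds i
  simp only [id]
  omega

section Base
variable {ds : List ℕ} {k : ℕ}

theorem alternatingInvariant_base (h : ds.length ≤ k) (hk : 2 ≤ k) (hds : ∀ x ∈ ds, k ≤ x) :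
    AlternatingInvariant (ds ++ [k]) (branchTree (ds ++ List.replicate (k - ds.length) 1)) := by
  set cs := ds ++ List.replicate (k - ds.length) 1 with hcs
  have hlen : cs.length = k := by simp [hcs]; omega
  have hmem_cs : ∀ x ∈ cs, k ≤ x ∨ (x = 1 ∧ k - ds.length ≠ 0) := by
    intro x hx
    rw [hcs, List.mem_append, List.mem_replicate] at hx
    exact hx.imp (hds x) And.symm
  have hmem : ∀ i, k ≤ cs.get i ∨ (cs.get i = 1 ∧ k - ds.length ≠ 0) :=
    fun i => hmem_cs _ (List.get_mem cs i)
  have hpos : ∀ i, 0 < cs.get i := fun i => by have := hmem i; omega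
  have hroot : deg (branchTree cs) none = k := by rw [deg_branchTree_none hpos, hlen]
  have hsum : ∀ g : ℕ → ℕ, ∑ x, g (deg (branchTree cs) x) =
      g k + ∑ i, (g (cs.get i) + (cs.get i - 1) * g 1) := by
    intro g
    rw [Fintype.sum_option, sum_deg_branchTree_some hpos, hroot]
  have hleafk : ∀ x y, (branchTree cs).Adj x y → deg (branchTree cs) x = 1 →
      k ≤ deg (branchTree cs) y := by
    intro x y hxy hx
    rcases x with _ | ⟨i, l⟩
    · omega
    · rcases y with _ | ⟨j, m⟩
      · omega
      · by_cases hij : i = j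
        · subst hij
          rw [branchTree_adj_some_same] at hxy
          rw [deg_branchTree_some] at hx ⊢
          have h1 := hmem i
          have h2 := l.2
          have h3 := m.2
          have h4 : (l : ℕ) ≠ m := fun h => hxy.1 (Fin.ext h)
          have h5 := hxy.2
          split_ifs at hx ⊢ <;> omega
        · exact absurd hxy (branchTree_not_adj_of_ne hij _ _)
  have htree := branchTree_isTree hpos
  have hA : ∀ t, k < t → ∀ Q : BranchVertex cs → Prop,
      (∀ x, deg (branchTree cs) x = 1 → Q x) →
      pairCount (branchTree cs) (fun u => t ≤ deg (branchTree cs) u) Q =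
      ∑ i, if t ≤ cs.get i then (if Q none then 1 else 0) + (cs.get i - 1) else 0 := by
    intro t ht Q hQ
    rw [pairCount_branchTree hpos]
    · refine Finset.sum_congr rfl fun i _ => ?_
      simp only [deg_branchTree_some, if_true]
    · omega
    · intro i l hl
      rw [deg_branchTree_some, if_neg hl]
      omega
    · intro i l hl
      apply hQ
      rw [deg_branchTree_some, if_neg hl]
  have hdeg : ∀ t, k < t → degSum (branchTree cs) (fun u => t ≤ deg (branchTree cs) u) =
      ∑ i, if t ≤ cs.get i then cs.get i else 0 := by
    intro t ht
    rw [degSum_eq_sum _ fun x => t ≤ x, hsum fun x => if t ≤ x then x else 0,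
      if_neg (by omega), if_neg (by omega)]
    simp
  have hdich : ∀ t, LeafDichotomy (branchTree cs) t := by
    intro t
    by_cases ht : t ≤ k
    · exact Or.inl fun x y hxy hx => ht.trans (hleafk x y hxy hx)
    -- A vertex of degree above `k` is a child of the root, and the root is its only neighbour that
    -- is not a leaf.
    · push Not at ht
      right
      rw [hA t ht _ (fun _ h => h), hdeg t ht, vertexCount_eq_sum _ fun x => t ≤ x,
        hsum fun x => if t ≤ x then 1 else 0, if_neg (by omega : ¬ t ≤ k), zero_add, ← Finset.sum_add_distrib]
      refine Finset.sum_congr rfl fun i _ => ?_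
      have := hpos i
      rw [if_neg (by omega : ¬ deg (branchTree cs) none = 1), if_neg (by omega : ¬ t ≤ 1)]
      split_ifs <;> omega
  refine ⟨htree, ⟨k - ds.length + ∑ i, (cs.get i - 1), ?_, ?_⟩,
    fun x y hxy hx => hk.trans (hleafk x y hxy hx), hdich, ?_⟩
  · by_contra hne
    have h1 : ∑ i, (cs.get i - 1) = 0 := by omega
    rw [Finset.sum_eq_zero_iff] at h1
    have h2 := h1 ⟨0, by omega⟩ (Finset.mem_univ _)
    have h3 := hmem ⟨0, by omega⟩
    omega
  · refine degreeSequence_eq_of_sum _ _ fun g => ?_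
    rw [hsum, Finset.sum_add_distrib, sum_get, ← Finset.sum_mul, hcs]
    simp only [List.map_append, List.sum_append, List.map_replicate, List.sum_replicate,
      List.map_cons, List.map_nil, List.sum_cons, List.sum_nil, Multiset.map_add, Multiset.sum_add,
      Multiset.map_coe, Multiset.sum_coe, Multiset.map_replicate, Multiset.sum_replicate,
      smul_eq_mul]
    ring
  · intro s t hst
    -- For `k < s`, every neighbour of a vertex of degree at least `t` is the root or a leaf, so the
    -- first bound is sharp. For `2 ≤ s ≤ k`, only leaves have degree below `s`.
    by_cases hs : s ≤ 1
    · exact attainsMixedBound_of_le_one t hs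
    by_cases hks : k < s
    · left
      rw [mixedCount, hA t (by omega) _ (fun x hx => by omega), hdeg t (by omega)]
      refine Finset.sum_congr rfl fun i _ => ?_
      have := hpos i
      rw [if_pos (by omega : deg (branchTree cs) none < s)]
      split_ifs <;> omega
    · refine attainsMixedBound_of_leafDichotomy hst (sum_deg_of_isTree htree) ?_
        (fun x y hxy hx => hk.trans (hleafk x y hxy hx)) (hdich t)
      intro x
      rcases x with _ | ⟨i, l⟩
      · omega
      · rw [deg_branchTree_some]
        have := hmem i
        split_ifs <;> omega

end Base

section Step
variable {ds es : List ℕ} {V : Type} [Fintype V] {S : SimpleGraph V} {v : V}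

theorem eq_of_adj_of_deg_eq_one {u x : V} (hv : deg S v = 1) (hu : S.Adj v u) (hx : S.Adj v x) :
    x = u := by
  rw [← degree_eq_deg, SimpleGraph.degree_eq_one_iff_existsUnique_adj] at hv
  exact hv.unique hx hu

/-- Only `v` changes degree within `S`, from 1 to `ds.length + 1`; the term `g 1` on the left stands
for the lost leaf and avoids subtraction. -/
theorem sum_comp_deg_identify_branchTree (hpos : ∀ i, 0 < ds.get i) (hv : deg S v = 1)
    (g : ℕ → ℕ) :
    ∑ x, g (deg (identify S v (branchTree ds)) x) + g 1 =
      ∑ a, g (deg S a) + g (ds.length + 1) + ∑ i, (g (ds.get i) + (ds.get i - 1) * g 1) := by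
  rw [Fintype.sum_sum_type, ← sum_deg_branchTree_some hpos]
  simp only [deg_identify_inl, deg_identify_inr, deg_branchTree_none hpos]
  rw [← Finset.sum_erase_add _ (fun a => g (deg S a + if a = v then ds.length else 0))
      (Finset.mem_univ v),
    ← Finset.sum_erase_add _ (fun a => g (deg S a)) (Finset.mem_univ v), hv, if_pos rfl,
    Finset.sum_congr rfl (fun a ha => by rw [if_neg (Finset.ne_of_mem_erase ha), add_zero]),
    add_comm 1 ds.length]
  ring

/-- Since `t` exceeds the degree of the merged vertex, this vertex is outside the high class before
and after gluing. -/
theorem pairCount_identify_branchTree (hpos : ∀ i, 0 < ds.get i) (hv : deg S v = 1) {t : ℕ}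
    (ht : ds.length + 1 < t) (Q : V ⊕ (Σ i : Fin ds.length, Fin (ds.get i)) → Prop)
    (hQ : ∀ x, deg (identify S v (branchTree ds)) x = 1 → Q x) :
    pairCount (identify S v (branchTree ds))
      (fun u => t ≤ deg (identify S v (branchTree ds)) u) Q =
      pairCount S (fun a => t ≤ deg S a) (fun a => Q (Sum.inl a)) +
      ∑ i, if t ≤ ds.get i then (if Q (Sum.inl v) then 1 else 0) + (ds.get i - 1) else 0 := by
  rw [pairCount_identify, pairCount_branchTree hpos]
  · congr 1
    · refine pairCount_congr S fun a b _ => and_congr_left fun _ => ?_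
      rw [deg_identify_inl, deg_branchTree_none hpos]
      split_ifs with h
      · subst h
        omega
      · rfl
    · refine Finset.sum_congr rfl fun i _ => ?_
      simp only [Option.elim_some, Option.elim_none, deg_identify_inr, deg_branchTree_some, if_true]
      congr!
  · simp only [Option.elim_none, deg_identify_inl, deg_branchTree_none hpos, if_true]
    omega
  · intro i l hl
    simp only [Option.elim_some, deg_identify_inr, deg_branchTree_some, if_neg hl]
    omega
  · intro i l hl
    apply hQ
    simp only [Option.elim_some, deg_identify_inr, deg_branchTree_some, if_neg hl]

/-- A leaf of the glued tree is either a leaf of `S` other than `v` or a leaf below one of the new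
branch vertices. -/
theorem le_deg_of_leaf_identify_branchTree (hds : ∀ i, 2 ≤ ds.get i) (hne : 0 < ds.length)
    {t : ℕ} (hS : ∀ a b, S.Adj a b → deg S a = 1 → t ≤ deg S b) (hv : deg S v = 1)
    (ht : ∀ i, t ≤ ds.get i)
    {x y : V ⊕ (Σ i : Fin ds.length, Fin (ds.get i))}
    (hxy : (identify S v (branchTree ds)).Adj x y)
    (hx : deg (identify S v (branchTree ds)) x = 1) :
    t ≤ deg (identify S v (branchTree ds)) y := by
  have hpos : ∀ i, 0 < ds.get i := fun i => by have := hds i; omega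
  rcases x with a | ⟨i, l⟩
  · rw [deg_identify_inl, deg_branchTree_none hpos] at hx
    have hav : a ≠ v := by
      rintro rfl
      rw [if_pos rfl] at hx
      omega
    rw [if_neg hav, add_zero] at hx
    rcases y with b | ⟨j, m⟩
    · rw [deg_identify_inl]
      exact (hS a b ((identify_adj_inl_inl _ _).mp hxy) hx).trans (Nat.le_add_right _ _)
    · exact absurd ((identify_adj_inl_inr _ _).mp hxy).1 hav
  · rw [deg_identify_inr, deg_branchTree_some] at hx
    have h2 := hds i
    have hl : (l : ℕ) ≠ 0 := by
      intro hl
      rw [if_pos hl] at hx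
      omega
    rcases y with b | ⟨j, m⟩
    · rw [identify_adj_inr_inl, branchTree_adj_none_some] at hxy
      exact absurd hxy.2 hl
    · rw [identify_adj_inr_inr] at hxy
      by_cases hij : i = j
      · subst hij
        rw [branchTree_adj_some_same] at hxy
        rw [deg_identify_inr, deg_branchTree_some, if_pos (hxy.2.resolve_left hl)]
        exact ht i
      · exact absurd hxy (branchTree_not_adj_of_ne hij _ _)

theorem alternatingInvariant_step (hS : AlternatingInvariant es S) (hv : IsMinLeaf S v)
    (hne : 0 < ds.length) (hdse : ∀ x ∈ ds, ∀ y ∈ es, y ≤ x)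
    (hds : ∀ x ∈ ds, ds.length + 1 ≤ x) (hes : ∀ x ∈ es, ds.length + 1 ≤ x) :
    AlternatingInvariant (ds ++ es ++ [ds.length + 1]) (identify S v (branchTree ds)) := by
  set G := identify S v (branchTree ds) with hG
  obtain ⟨hv1, u, hvu, hmin⟩ := hv
  simp only [degree_eq_deg] at hv1 hmin
  have hdsi : ∀ i, ds.length + 1 ≤ ds.get i := fun i => hds _ (List.get_mem ds i)
  have hpos : ∀ i, 0 < ds.get i := fun i => by have := hdsi i; omega
  have hsum := sum_comp_deg_identify_branchTree (S := S) hpos hv1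
  rw [← hG] at hsum
  have hub : ∀ i x, 2 ≤ deg S x → deg S x ≤ ds.get i := by
    intro i x hx
    rcases hS.deg_eq x with h | h
    · exact hdse _ (List.get_mem ds i) _ h
    · omega
  have hcard : Fintype.card (V ⊕ (Σ i : Fin ds.length, Fin (ds.get i))) =
      Fintype.card V + ∑ i, ds.get i := by
    rw [Fintype.card_sum, Fintype.card_sigma]
    simp
  have hsub : ∑ i, (ds.get i - 1) + ds.length = ∑ i, ds.get i := by
    have := sum_get_sub_one ds hpos fun _ => 1
    have h2 := sum_get ds id
    simp only [mul_one, id, List.map_id_fun] at this h2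
    rw [this, h2]
  have hSsum := sum_deg_of_isTree hS.isTree
  have hGsum : ∑ x, deg G x + 2 = 2 * Fintype.card (V ⊕ (Σ i : Fin ds.length, Fin (ds.get i))) := by
    have := hsum fun x => x
    simp only [mul_one, Finset.sum_add_distrib] at this
    rw [hcard]
    omega
  have hleaf2 : ∀ x y, G.Adj x y → deg G x = 1 → 2 ≤ deg G y := fun x y hxy hx =>
    le_deg_of_leaf_identify_branchTree (fun i => by have := hdsi i; omega) hne hS.two_le_of_leaf hv1
      (fun i => by have := hdsi i; omega) hxy hx
  obtain ⟨L, hL, hdegS⟩ := hS.degreeSequence_eq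
  have hseq : degreeSequence G = ((ds ++ es ++ [ds.length + 1] : List ℕ) : Multiset ℕ) +
      Multiset.replicate (L - 1 + ∑ i, (ds.get i - 1)) 1 := by
    refine degreeSequence_eq_of_sum _ _ fun g => ?_
    have h1 := hsum g
    rw [sum_comp_deg S g, hdegS, Finset.sum_add_distrib, sum_get, ← Finset.sum_mul] at h1
    obtain ⟨M, rfl⟩ := Nat.exists_eq_succ_of_ne_zero hL.ne'
    simp only [List.map_append, List.sum_append,
      List.map_cons, List.map_nil, List.sum_cons, List.sum_nil, Multiset.map_add, Multiset.sum_add,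
      Multiset.map_coe, Multiset.sum_coe, Multiset.map_replicate, Multiset.sum_replicate,
      smul_eq_mul, Nat.succ_eq_add_one, Nat.add_sub_cancel] at h1 ⊢
    linarith
  have hbig : ∀ x, deg G x ≠ 1 → ds.length + 1 ≤ deg G x := by
    intro x hx
    have := mem_degreeSequence.mpr ⟨x, (rfl : deg G x = deg G x)⟩
    rw [hseq, Multiset.mem_add, Multiset.mem_coe, List.mem_append, List.mem_append,
      List.mem_singleton] at this
    rcases this with ((h | h) | h) | h
    · exact hds _ h
    · exact hes _ h
    · exact h.ge
    · exact absurd (Multiset.eq_of_mem_replicate h) hx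
  have hdegA : ∀ t, ds.length + 1 < t → degSum G (fun x => t ≤ deg G x) =
      degSum S (fun x => t ≤ deg S x) + ∑ i, if t ≤ ds.get i then ds.get i else 0 := by
    intro t ht
    have := hsum fun x => if t ≤ x then x else 0
    rw [← degSum_eq_sum G fun x => t ≤ x, ← degSum_eq_sum S fun x => t ≤ x,
      if_neg (by omega), if_neg (by omega)] at this
    simpa using this
  have hcntA : ∀ t, ds.length + 1 < t → vertexCount (fun x => t ≤ deg G x) =
      vertexCount (fun x => t ≤ deg S x) + ∑ i, if t ≤ ds.get i then 1 else 0 := by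
    intro t ht
    have := hsum fun x => if t ≤ x then 1 else 0
    rw [← vertexCount_eq_sum G fun x => t ≤ x, ← vertexCount_eq_sum S fun x => t ≤ x,
      if_neg (by omega), if_neg (by omega)] at this
    simpa only [mul_zero, add_zero] using this
  have hdich : ∀ t, LeafDichotomy G t := by
    intro t
    by_cases htk : t ≤ ds.length + 1
    · exact Or.inl fun x y hxy hx => htk.trans (hbig y (by have := hleaf2 x y hxy hx; omega))
    push Not at htk
    -- Minimality of `u` decides the alternative. If `t ≤ deg S u`, all old leaf neighbours have
    -- degree at least `t`, and so do the new branch vertices, whose degrees dominate that of `u`.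
    -- Otherwise `v` refutes the first alternative for `S`, and losing the leaf `v` does not affect
    -- the count, because `u` is not in the high class. Each new high vertex has the merged vertex
    -- as its only non-leaf neighbour.
    by_cases htu : t ≤ deg S u
    · refine Or.inl fun x y hxy hx =>
        le_deg_of_leaf_identify_branchTree (fun i => by have := hdsi i; omega) hne
          (fun a b hab ha => htu.trans (hmin a b ha hab)) hv1 (fun i => ?_) hxy hx
      exact htu.trans (hub i u (by omega))
    · right
      have hSd := (hS.leafDichotomy t).resolve_left fun h => htu (h v u hvu hv1)
      have hvG : deg G (Sum.inl v) ≠ 1 := by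
        rw [hG, deg_identify_inl, if_pos rfl, deg_branchTree_none hpos]
        omega
      have hcount := pairCount_identify_branchTree (S := S) hpos hv1 htk
        (fun x => deg G x = 1) (fun _ h => h)
      have hpc : pairCount S (fun a => t ≤ deg S a) (fun a => deg G (Sum.inl a) = 1) =
          pairCount S (fun a => t ≤ deg S a) (fun a => deg S a = 1) := by
        refine pairCount_congr S fun a b hab => and_congr_right fun ha => ?_
        have hbv : b ≠ v := by
          rintro rfl
          exact htu (eq_of_adj_of_deg_eq_one hv1 hvu hab.symm ▸ ha)
        rw [hG, deg_identify_inl, if_neg hbv, add_zero]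
      simp only [hpc, if_neg hvG, zero_add] at hcount
      rw [hcount, hcntA t htk, hdegA t htk, ← hSd]
      have : ∑ i, (if t ≤ ds.get i then ds.get i - 1 else 0) + ∑ i, (if t ≤ ds.get i then 1 else 0) =
          ∑ i, if t ≤ ds.get i then ds.get i else 0 := by
        rw [← Finset.sum_add_distrib]
        refine Finset.sum_congr rfl fun i _ => ?_
        have := hpos i
        split_ifs <;> omega
      omega
  have hconn : G.Connected :=
    identify_connected hS.isTree.connected (branchTree_isTree hpos).connected
  refine ⟨isTree_of_connected_of_sum_deg hconn hGsum, ⟨_, ?_, hseq⟩, hleaf2, hdich, ?_⟩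
  · have := Finset.single_le_sum (f := fun i => ds.get i - 1) (fun _ _ => Nat.zero_le _)
      (Finset.mem_univ ⟨0, hne⟩)
    have := hdsi ⟨0, hne⟩
    omega
  intro s t hst
  by_cases hs : s ≤ 1
  · exact attainsMixedBound_of_le_one t hs
  by_cases hks : s ≤ ds.length + 1
  · refine attainsMixedBound_of_leafDichotomy hst hGsum ?_ hleaf2 (hdich t)
    intro x
    have := hbig x
    omega
  have htk : ds.length + 1 < t := by omega
  have hcount : mixedCount G s t =
      mixedCount S s t + ∑ i, if t ≤ ds.get i then ds.get i else 0 := by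
    rw [mixedCount, hG, pairCount_identify_branchTree hpos hv1 htk _ (fun x hx => by omega)]
    congr 1
    · refine pairCount_congr S fun a b _ => and_congr_right fun _ => ?_
      rw [deg_identify_inl, deg_branchTree_none hpos]
      split_ifs with h
      · subst h
        omega
      · rfl
    · refine Finset.sum_congr rfl fun i _ => ?_
      have := hpos i
      rw [deg_identify_inl, deg_branchTree_none hpos, if_pos rfl, hv1,
        if_pos (by omega : 1 + ds.length < s)]
      split_ifs <;> omega
  -- If `S` has a vertex of degree at least `t`, then so are all entries of `ds`. In that case
  -- `mixedCount` and all four bounds grow by the sum of `ds`, while the middle class is unchanged,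
  -- so the sharp bound of `S` stays sharp. If not, all high vertices are new and all their
  -- neighbours have degree below `s`, which is the first bound.
  by_cases hA : ∃ a, t ≤ deg S a
  · obtain ⟨a, ha⟩ := hA
    have hti : ∀ i, t ≤ ds.get i := fun i => ha.trans (hub i a (by omega))
    have e1 := hdegA t htk
    have e2 := hcntA t htk
    simp only [hti, if_true, Finset.sum_const, Finset.card_univ, Fintype.card_fin, smul_eq_mul,
      mul_one] at hcount e1 e2
    have e3 : degSum G (fun x => deg G x < s) =
        degSum S (fun x => deg S x < s) + ∑ i, ds.get i := by
      have := hsum fun x => if x < s then x else 0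
      rw [← degSum_eq_sum G fun x => x < s, ← degSum_eq_sum S fun x => x < s,
        if_pos (by omega), if_pos (by omega),
        Finset.sum_congr rfl fun i _ => by
          rw [if_neg (by have := hti i; omega), zero_add, mul_one]] at this
      omega
    have e4 : vertexCount (fun x => deg G x < s) + ds.length =
        vertexCount (fun x => deg S x < s) + ∑ i, ds.get i := by
      have := hsum fun x => if x < s then 1 else 0
      rw [← vertexCount_eq_sum G fun x => x < s, ← vertexCount_eq_sum S fun x => x < s,
        if_pos (by omega), if_pos (by omega),
        Finset.sum_congr rfl fun i _ => by
          rw [if_neg (by have := hti i; omega), zero_add, mul_one]] at this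
      omega
    have e5 : degSum G (fun x => ¬ t ≤ deg G x ∧ ¬ deg G x < s) =
        degSum S (fun x => ¬ t ≤ deg S x ∧ ¬ deg S x < s) := by
      have := hsum fun x => if ¬ t ≤ x ∧ ¬ x < s then x else 0
      rw [← degSum_eq_sum G fun x => ¬ t ≤ x ∧ ¬ x < s,
        ← degSum_eq_sum S fun x => ¬ t ≤ x ∧ ¬ x < s,
        if_neg (by omega), if_neg (by omega),
        Finset.sum_congr rfl fun i _ => by
          rw [if_neg (by have := hti i; omega), zero_add, mul_zero]] at this
      simpa using this
    have e6 : vertexCount (fun x => ¬ t ≤ deg G x ∧ ¬ deg G x < s) =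
        vertexCount (fun x => ¬ t ≤ deg S x ∧ ¬ deg S x < s) := by
      have := hsum fun x => if ¬ t ≤ x ∧ ¬ x < s then 1 else 0
      rw [← vertexCount_eq_sum G fun x => ¬ t ≤ x ∧ ¬ x < s,
        ← vertexCount_eq_sum S fun x => ¬ t ≤ x ∧ ¬ x < s,
        if_neg (by omega), if_neg (by omega),
        Finset.sum_congr rfl fun i _ => by
          rw [if_neg (by have := hti i; omega), zero_add, mul_zero]] at this
      simpa using this
    rcases hS.attains s t hst with h | h | h | ⟨⟨x, hx⟩, h⟩
    · left; omega
    · right; left; omega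
    · right; right; left; omega
    · right; right; right
      refine ⟨⟨Sum.inl x, ?_⟩, ?_⟩
      · have hxv : x ≠ v := by
          rintro rfl
          omega
        rw [hG, deg_identify_inl, if_neg hxv]
        exact hx
      · omega
  · left
    have h1 : degSum S (fun x => t ≤ deg S x) = 0 :=
      Finset.sum_eq_zero fun x _ => if_neg fun hx => hA ⟨x, hx⟩
    have h2 : mixedCount S s t ≤ _ := pairCount_le_degSum_left _ _ _
    rw [hcount, hdegA t htk]
    omega

end Step

/-! ### The invariant along the recursion, and existence -/

theorem alternatingInvariant_of_build {d : List ℕ} {W : Type} {G : SimpleGraph W}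
    (h : AlternatingGreedyBuild d W G) (hd : d.Pairwise (· ≥ ·)) (h2 : ∀ x ∈ d, 2 ≤ x) :
    ∃ _ : Fintype W, AlternatingInvariant d G := by
  induction h with
  | base ds k h =>
    rw [List.pairwise_append] at hd
    exact ⟨inferInstance, alternatingInvariant_base h (h2 k (by simp))
      fun x hx => hd.2.2 x hx k (by simp)⟩
  | @step ds es k hds hk V instV S hS v hv ih =>
    subst hds
    rw [List.pairwise_append, List.pairwise_append] at hd
    obtain ⟨⟨hds, hes, hdse⟩, -, hlast⟩ := hd
    obtain ⟨inst, hinv⟩ := ih hes fun x hx => h2 x (by simp [hx])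
    obtain rfl := Subsingleton.elim instV inst
    have := h2 (ds.length + 1) (by simp)
    exact ⟨inferInstance, alternatingInvariant_step hinv hv (by omega)
      hdse
      (fun x hx => hlast x (by simp [hx]) _ (by simp))
      (fun x hx => hlast x (by simp [hx]) _ (by simp))⟩

theorem exists_alternatingGreedyBuild (d : List ℕ) (hne : d ≠ []) (hd : d.Pairwise (· ≥ ·))
    (h2 : ∀ x ∈ d, 2 ≤ x) : ∃ (W : Type) (G : SimpleGraph W), AlternatingGreedyBuild d W G := by
  induction hn : d.length using Nat.strong_induction_on generalizing d with
  | _ n ih =>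
    obtain ⟨init, k, rfl⟩ := List.eq_nil_or_concat' d |>.resolve_left hne
    by_cases hk : init.length ≤ k
    · exact ⟨_, _, AlternatingGreedyBuild.base init k hk⟩
    · have hk2 := h2 k (by simp)
      have hsplit : init = init.take (k - 1) ++ init.drop (k - 1) :=
        (List.take_append_drop _ _).symm
      set ds := init.take (k - 1) with hds
      set es := init.drop (k - 1) with hes
      have hdl : ds.length = k - 1 := by rw [hds, List.length_take]; omega
      have hel : es.length = init.length - (k - 1) := by rw [hes, List.length_drop]
      rw [List.pairwise_append] at hd
      have hes2 : ∀ x ∈ es, 2 ≤ x := fun x hx =>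
        h2 x (List.mem_append_left _ (List.mem_of_mem_drop hx))
      have hesP : es.Pairwise (· ≥ ·) := hd.1.sublist (List.drop_sublist _ _)
      obtain ⟨V, S, hS⟩ := ih es.length
        (by rw [← hn, hel, List.length_append, List.length_singleton]; omega) es
        (List.ne_nil_of_length_pos (by omega)) hesP hes2 rfl
      obtain ⟨inst, hinv⟩ := alternatingInvariant_of_build hS hesP hes2
      obtain ⟨L, hL, hseq⟩ := hinv.degreeSequence_eq
      -- The recursion can continue because the invariant provides a leaf; a minimal choice of its
      -- neighbour's degree then gives `IsMinLeaf`.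
      have hleaf : ∃ v, deg S v = 1 := by
        rw [← mem_degreeSequence, hseq, Multiset.mem_add]
        exact Or.inr (Multiset.mem_replicate.mpr ⟨hL.ne', rfl⟩)
      have hnbr : ∀ v, deg S v = 1 → ∃ u, S.Adj v u := by
        intro v hv
        rw [← degree_eq_deg, SimpleGraph.degree_eq_one_iff_existsUnique_adj] at hv
        exact hv.exists
      have hex : ∃ m v u, deg S v = 1 ∧ S.Adj v u ∧ deg S u = m := by
        obtain ⟨v, hv⟩ := hleaf
        obtain ⟨u, hu⟩ := hnbr v hv
        exact ⟨_, v, u, hv, hu, rfl⟩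
      obtain ⟨v, u, hv, hu, hm⟩ := Nat.find_spec hex
      have hmin : IsMinLeaf S v := by
        refine ⟨by rw [degree_eq_deg, hv], u, hu, fun v' u' hv' hu' => ?_⟩
        rw [degree_eq_deg] at hv'
        rw [degree_eq_deg, degree_eq_deg, hm]
        exact Nat.find_min' hex ⟨v', u', hv', hu', rfl⟩
      rw [hsplit]
      exact ⟨_, _, AlternatingGreedyBuild.step ds es k (by omega) (by omega) V S hS v hmin⟩

/-! ### The greedy tree -/

section Greedy
variable {d : List ℕ}

theorem greedyFirstChild_monotone : Monotone (greedyFirstChild d) :=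
  monotone_nat_of_le_succ fun _ => Nat.le_add_right _ _

theorem getD_antitone (hd : d.Pairwise (· ≥ ·)) {i j : ℕ} (hij : i ≤ j) :
    d.getD j 0 ≤ d.getD i 0 := by
  by_cases hj : j < d.length
  · rcases hij.eq_or_lt with rfl | hlt
    · rfl
    · rw [List.getD_eq_getElem _ _ hj, List.getD_eq_getElem _ _ (hlt.trans hj)]
      exact List.pairwise_iff_getElem.mp hd i j _ hj hlt
  · rw [List.getD_eq_default _ _ (by omega)]
    exact Nat.zero_le _

theorem one_le_getD (hpos : ∀ x ∈ d, 1 ≤ x) {i : ℕ} (hi : i < d.length) : 1 ≤ d.getD i 0 := by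
  rw [List.getD_eq_getElem _ _ hi]
  exact hpos _ (List.getElem_mem hi)

/-- The children of `0, …, i` take consecutive numbers from 1 on; each label except the root's
counts one parent, which accounts for the constant 2. -/
theorem greedyFirstChild_add (hpos : ∀ x ∈ d, 1 ≤ x) {i : ℕ} (hi : i < d.length) :
    greedyFirstChild d (i + 1) + (i + 1) = 2 + ∑ l ∈ range (i + 1), d.getD l 0 := by
  induction i with
  | zero =>
    simp only [greedyFirstChild, greedyNumChildren, if_true, zero_add, Finset.sum_range_one]
    omega
  | succ i ih =>
    have h1 := ih (by omega)
    have h2 := one_le_getD hpos hi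
    rw [Finset.sum_range_succ, greedyFirstChild, greedyNumChildren, if_neg (by omega)]
    omega

theorem sum_range_getD (d : List ℕ) : ∑ l ∈ range d.length, d.getD l 0 = d.sum := by
  have := sum_get d id
  rw [List.map_id] at this
  rw [← this, ← Fin.sum_univ_eq_sum_range]
  exact Finset.sum_congr rfl fun i _ => by simp

theorem greedyFirstChild_length (hpos : ∀ x ∈ d, 1 ≤ x) (hsum : d.sum + 2 = 2 * d.length) :
    greedyFirstChild d d.length = d.length := by
  obtain ⟨m, hm⟩ := Nat.exists_eq_succ_of_ne_zero (n := d.length) (by omega)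
  have h := greedyFirstChild_add hpos (i := m) (by omega)
  rw [← Nat.succ_eq_add_one, ← hm, sum_range_getD] at h
  omega

/-- The numbering never stalls. If it did, the labels so far would average below 2, so one of them
is at most 1, hence so are all later ones, and the total would fall short of `2 * d.length - 2`. -/
theorem lt_greedyFirstChild (hd : d.Pairwise (· ≥ ·)) (hpos : ∀ x ∈ d, 1 ≤ x)
    (hsum : d.sum + 2 = 2 * d.length) {i : ℕ} (hi : i < d.length) : i < greedyFirstChild d i := by
  rcases i with _ | i
  · exact Nat.one_pos
  · by_contra hlt
    have h1 := greedyFirstChild_add hpos (i := i) (by omega)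
    have h2 : ∃ l ∈ range (i + 1), d.getD l 0 < 2 := by
      apply Finset.exists_lt_of_sum_lt
      rw [Finset.sum_const, Finset.card_range, smul_eq_mul]
      omega
    obtain ⟨l, hl, hl2⟩ := h2
    rw [Finset.mem_range] at hl
    have h3 : ∑ l ∈ Ico (i + 1) d.length, d.getD l 0 ≤ ∑ l ∈ Ico (i + 1) d.length, 1 := by
      refine Finset.sum_le_sum fun j hj => ?_
      have := getD_antitone hd (i := l) (j := j) (by have := Finset.mem_Ico.mp hj; omega)
      omega
    have h4 := Finset.sum_range_add_sum_Ico (fun l => d.getD l 0) hi.le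
    rw [sum_range_getD] at h4
    rw [Finset.sum_const, Nat.card_Ico, smul_eq_mul] at h3
    omega

/-- The parent of vertex `j` of the greedy tree. -/
def greedyParent (d : List ℕ) (j : Fin d.length) : Fin d.length :=
  ⟨Nat.findGreatest (fun i => greedyFirstChild d i ≤ j) j,
    (Nat.findGreatest_le _).trans_lt j.2⟩

variable (hd : d.Pairwise (· ≥ ·)) (hpos : ∀ x ∈ d, 1 ≤ x) (hsum : d.sum + 2 = 2 * d.length)

theorem greedyFirstChild_greedyParent_le {j : Fin d.length} (hj : (j : ℕ) ≠ 0) :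
    greedyFirstChild d (greedyParent d j) ≤ j :=
  Nat.findGreatest_spec (P := fun i => greedyFirstChild d i ≤ j) (Nat.zero_le (j : ℕ))
    (Nat.one_le_iff_ne_zero.mpr hj)

include hd hpos hsum in
theorem greedyParent_lt {j : Fin d.length} (hj : (j : ℕ) ≠ 0) :
    (greedyParent d j : ℕ) < j :=
  (lt_greedyFirstChild hd hpos hsum (greedyParent d j).2).trans_le
    (greedyFirstChild_greedyParent_le hj)

include hd hpos hsum in
theorem lt_greedyFirstChild_greedyParent {j : Fin d.length} (hj : (j : ℕ) ≠ 0) :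
    (j : ℕ) < greedyFirstChild d (greedyParent d j + 1) := by
  by_contra h
  exact Nat.findGreatest_is_greatest (P := fun i => greedyFirstChild d i ≤ j) (n := j)
    (Nat.lt_succ_self _) (greedyParent_lt hd hpos hsum hj) (not_lt.mp h)

include hd hpos hsum in
-- The blocks of children are consecutive intervals, possibly empty; the greatest admissible index
-- is the one whose block contains `j`.
theorem greedyParent_eq_iff (i j : Fin d.length) :
    ((j : ℕ) ≠ 0 ∧ greedyParent d j = i) ↔
      greedyFirstChild d i ≤ j ∧ (j : ℕ) < greedyFirstChild d (i + 1) := by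
  constructor
  · rintro ⟨hj, rfl⟩
    exact ⟨greedyFirstChild_greedyParent_le hj, lt_greedyFirstChild_greedyParent hd hpos hsum hj⟩
  · rintro ⟨h1, h2⟩
    have hj : (j : ℕ) ≠ 0 := by
      have := greedyFirstChild_monotone (d := d) (Nat.zero_le i)
      have h0 : greedyFirstChild d 0 = 1 := rfl
      omega
    have h3 := greedyFirstChild_greedyParent_le hj
    have h4 := lt_greedyFirstChild_greedyParent hd hpos hsum hj
    refine ⟨hj, Fin.ext ?_⟩
    by_contra hne
    rcases Nat.lt_or_gt_of_ne hne with h | h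
    · have := greedyFirstChild_monotone (d := d) (Nat.succ_le_of_lt h)
      simp only [Nat.succ_eq_add_one] at this
      omega
    · have := greedyFirstChild_monotone (d := d) (Nat.succ_le_of_lt h)
      simp only [Nat.succ_eq_add_one] at this
      omega

include hd hpos hsum in
theorem greedyParent_monotone {x y : Fin d.length} (hx : (x : ℕ) ≠ 0) (hxy : x ≤ y) :
    greedyParent d x ≤ greedyParent d y := by
  have hy : (y : ℕ) ≠ 0 := by
    have : (x : ℕ) ≤ y := hxy
    omega
  by_contra h
  rw [not_le] at h
  have h1 := greedyFirstChild_monotone (d := d) (Nat.succ_le_of_lt h)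
  have h2 := greedyFirstChild_greedyParent_le hx
  have h3 := lt_greedyFirstChild_greedyParent hd hpos hsum hy
  simp only [Nat.succ_eq_add_one] at h1
  have : (x : ℕ) ≤ y := hxy
  omega

include hd hpos hsum in
theorem greedyTreeOfList_adj_iff {r : Fin d.length} (hr : (r : ℕ) = 0) (x y : Fin d.length) :
    (greedyTreeOfList d).Adj x y ↔
      (y ≠ r ∧ greedyParent d y = x) ∨ (x ≠ r ∧ greedyParent d x = y) := by
  have hne : ∀ z : Fin d.length, z ≠ r ↔ (z : ℕ) ≠ 0 := fun z => by rw [ne_eq, Fin.ext_iff, hr]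
  rw [hne, hne, greedyParent_eq_iff hd hpos hsum, greedyParent_eq_iff hd hpos hsum,
    greedyTreeOfList, SimpleGraph.fromRel_adj]
  refine and_iff_right_of_imp fun h => ?_
  rintro rfl
  have := lt_greedyFirstChild hd hpos hsum x.2
  rcases h with h | h <;> exact absurd h.1 (by omega)

include hd hpos hsum in
theorem deg_greedyTreeOfList (i : Fin d.length) : deg (greedyTreeOfList d) i = d.get i := by
  have hlen : 0 < d.length := Fin.pos i
  set r : Fin d.length := ⟨0, hlen⟩ with hr
  have hρ : ∀ x : Fin d.length, x ≠ r → (greedyParent d x : ℕ) < x := fun x hx =>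
    greedyParent_lt hd hpos hsum fun h => hx (Fin.ext h)
  rw [deg_eq_pairCount, pairCount_of_parent hρ (greedyTreeOfList_adj_iff hd hpos hsum rfl)]
  have h1 : ∀ x : Fin d.length, (if x ≠ r then (if greedyParent d x = i ∧ True then 1 else 0) +
      (if x = i ∧ True then 1 else 0) else 0) =
      (if greedyFirstChild d i ≤ x ∧ (x : ℕ) < greedyFirstChild d (i + 1) then 1 else 0) +
        (if x = i then (if i ≠ r then 1 else 0) else 0) := by
    intro x
    rw [if_congr (greedyParent_eq_iff hd hpos hsum i x).symm rfl rfl]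
    have hne : x ≠ r ↔ (x : ℕ) ≠ 0 := by rw [ne_eq, Fin.ext_iff]
    by_cases hx : x = i
    · subst hx
      by_cases h0 : x = r <;> simp_all
    · by_cases h0 : x = r <;> simp_all
  have h2 := Fin.sum_univ_eq_sum_range (fun x => if greedyFirstChild d i ≤ x ∧
    x < greedyFirstChild d (i + 1) then 1 else 0) d.length
  have h3 : (range d.length).filter (fun x => greedyFirstChild d i ≤ x ∧
      x < greedyFirstChild d (i + 1)) =
      Ico (greedyFirstChild d i) (greedyFirstChild d (i + 1)) := by
    have := greedyFirstChild_monotone (d := d) (Nat.succ_le_of_lt i.2)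
    rw [greedyFirstChild_length hpos hsum, Nat.succ_eq_add_one] at this
    ext x
    simp only [Finset.mem_filter, Finset.mem_range, Finset.mem_Ico]
    omega
  have h4 : ∑ x : Fin d.length, (if greedyFirstChild d i ≤ x ∧
      (x : ℕ) < greedyFirstChild d (i + 1) then 1 else 0) = greedyNumChildren d i := by
    rw [h2, ← Finset.sum_filter, h3]
    simp [greedyFirstChild]
  refine (Finset.sum_congr rfl fun x _ => Eq.trans (by congr!) (h1 x)).trans ?_
  rw [Finset.sum_add_distrib, h4, Finset.sum_ite_eq',
    if_pos (Finset.mem_univ _), greedyNumChildren, List.getD_eq_getElem _ _ i.2]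
  have := hpos _ (List.get_mem d i)
  have hne : i ≠ r ↔ (i : ℕ) ≠ 0 := by rw [ne_eq, Fin.ext_iff]
  rw [List.get_eq_getElem] at *
  by_cases h0 : (i : ℕ) = 0
  · rw [if_pos h0, if_neg (by rw [hne]; exact not_not.mpr h0), add_zero,
      ← List.getD_eq_getElem _ 0 i.2, h0]
  · rw [if_neg h0, if_pos (hne.mpr h0)]
    omega

include hd hpos hsum in
theorem greedyTreeOfList_isTree : (greedyTreeOfList d).IsTree := by
  have hlen : 0 < d.length := by omega
  exact isTree_of_parent (r := ⟨0, hlen⟩) (ρ := Fin.val) (fun x hx =>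
    greedyParent_lt hd hpos hsum fun h => hx (Fin.ext h))
    (greedyTreeOfList_adj_iff hd hpos hsum rfl)

include hd hpos hsum in
theorem degreeSequence_greedyTreeOfList : degreeSequence (greedyTreeOfList d) = d := by
  refine degreeSequence_eq_of_sum _ _ fun g => ?_
  simp only [deg_greedyTreeOfList hd hpos hsum]
  rw [sum_get, Multiset.map_coe, Multiset.sum_coe]

include hd hpos hsum in
theorem highCount_greedyTreeOfList {s t : ℕ} (hst : s ≤ t) :
    highCount (greedyTreeOfList d) s t =
        degSum (greedyTreeOfList d) (fun v => t ≤ deg (greedyTreeOfList d) v) ∨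
      vertexCount (fun v => t ≤ deg (greedyTreeOfList d) v) +
          vertexCount (fun v => s ≤ deg (greedyTreeOfList d) v) ≤
        highCount (greedyTreeOfList d) s t + 2 := by
  have hlen : 0 < d.length := by omega
  set r : Fin d.length := ⟨0, hlen⟩ with hr
  have hρ : ∀ x : Fin d.length, x ≠ r → (greedyParent d x : ℕ) < x := fun x hx =>
    greedyParent_lt hd hpos hsum fun h => hx (Fin.ext h)
  have hanti : ∀ x y : Fin d.length, x ≤ y → d.get y ≤ d.get x := by
    intro x y hxy
    have := getD_antitone hd (i := x) (j := y) hxy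
    rwa [List.getD_eq_getElem _ _ y.2, List.getD_eq_getElem _ _ x.2] at this
  have hadj := greedyTreeOfList_adj_iff hd hpos hsum (r := r) rfl
  unfold highCount
  simp only [deg_greedyTreeOfList hd hpos hsum]
  -- If this holds, each non-root vertex of degree at least `s`, and each of degree at least `t`,
  -- gives one pair with its parent; only the root is missing, once from each class.
  by_cases hall : ∀ x, x ≠ r → s ≤ d.get x → t ≤ d.get (greedyParent d x)
  · right
    rw [pairCount_of_parent hρ hadj]
    unfold vertexCount
    have h0 : ∑ x : Fin d.length, (if x = r then 2 else 0) = 2 := by simp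
    refine le_of_le_of_eq ?_ (congrArg _ h0)
    rw [← Finset.sum_add_distrib, ← Finset.sum_add_distrib]
    refine Finset.sum_le_sum fun x _ => ?_
    by_cases hxr : x = r
    · rw [if_pos hxr]
      split_ifs <;> omega
    · have h2 := hall x hxr
      have h3 := hanti (greedyParent d x) x (hρ x hxr).le
      rw [if_pos hxr, if_neg hxr]
      split_ifs <;> omega
  -- A neighbour `a` of a high vertex with degree below `s` would be a child coming after `x`. Then
  -- its parent would come no earlier than that of `x`, so its degree would be below `t`.
  · left
    push Not at hall
    obtain ⟨x, hxr, hsx, hxt⟩ := hall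
    rw [← pairCount_true_left]
    refine pairCount_congr _ fun a b hab => and_congr_left fun hb => iff_true_intro ?_
    rcases (hadj a b).mp hab with ⟨hbr, rfl⟩ | ⟨har, rfl⟩
    · exact hst.trans (hb.trans (hanti _ _ (hρ b hbr).le))
    · by_contra ha
      have hxa : x ≤ a := by
        by_contra h
        have := hanti a x (not_le.mp h).le
        omega
      have := hanti _ _ (greedyParent_monotone hd hpos hsum (fun h => hxr (Fin.ext h)) hxa)
      omega

end Greedy

/-! ### Trees with a given degree sequence -/

section
variable {V : Type*} [Fintype V] {T : SimpleGraph V} {D : Multiset ℕ}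

theorem IsTreeWithDegrees.sum_add_two (h : IsTreeWithDegrees D T) : D.sum + 2 = 2 * D.card := by
  have h1 := sum_deg_of_isTree h.1
  have h2 := sum_comp_deg T fun x => x
  rw [h2, h.2, Multiset.map_id', ← card_degreeSequence T, h.2] at h1
  exact h1

theorem IsTreeWithDegrees.one_le (h : IsTreeWithDegrees D T) (hD : 2 ≤ D.card) :
    ∀ x ∈ D, 1 ≤ x := by
  intro x hx
  rw [← h.2] at hx
  obtain ⟨v, rfl⟩ := mem_degreeSequence.mp hx
  have : Nontrivial V := by
    rw [← Fintype.one_lt_card_iff_nontrivial, ← card_degreeSequence T, h.2]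
    omega
  exact deg_pos_of_connected h.1.connected v

end

theorem isTreeWithDegrees_greedyTree {D : Multiset ℕ} (hpos : ∀ x ∈ D, 1 ≤ x)
    (hsum : D.sum + 2 = 2 * D.card) : IsTreeWithDegrees D (greedyTree D) ∧
      ∀ s t, s ≤ t → highCount (greedyTree D) s t =
        degSum (greedyTree D) (fun v => t ≤ deg (greedyTree D) v) ∨
      vertexCount (fun v => t ≤ deg (greedyTree D) v) +
          vertexCount (fun v => s ≤ deg (greedyTree D) v) ≤ highCount (greedyTree D) s t + 2 := by
  have h1 : (D.sort (· ≥ ·)).Pairwise (· ≥ ·) := D.pairwise_sort _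
  have h2 : ∀ x ∈ D.sort (· ≥ ·), 1 ≤ x := fun x hx => hpos x ((Multiset.mem_sort _).mp hx)
  have h3 : (D.sort (· ≥ ·)).sum + 2 = 2 * (D.sort (· ≥ ·)).length := by
    rw [Multiset.length_sort, ← hsum, ← Multiset.sum_coe, Multiset.sort_eq]
  refine ⟨⟨greedyTreeOfList_isTree h1 h2 h3, ?_⟩, fun s t hst =>
    highCount_greedyTreeOfList h1 h2 h3 hst⟩
  rw [greedyTree, degreeSequence_greedyTreeOfList h1 h2 h3, Multiset.sort_eq]

section
variable {D : Multiset ℕ}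

theorem internalDegrees_pairwise (D : Multiset ℕ) : (internalDegrees D).Pairwise (· ≥ ·) :=
  Multiset.pairwise_sort _ _

theorem two_le_of_mem_internalDegrees (D : Multiset ℕ) : ∀ x ∈ internalDegrees D, 2 ≤ x := by
  intro x hx
  rw [internalDegrees, Multiset.mem_sort, Multiset.mem_filter] at hx
  exact hx.2

theorem coe_internalDegrees_add (hpos : ∀ x ∈ D, 1 ≤ x) :
    ∃ L, D = (internalDegrees D : Multiset ℕ) + Multiset.replicate L 1 := by
  refine ⟨(D.filter fun k => ¬ 1 < k).card, ?_⟩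
  rw [internalDegrees, Multiset.sort_eq]
  conv_lhs => rw [← Multiset.filter_add_not (fun k => 1 < k) D]
  congr 1
  rw [Multiset.eq_replicate]
  refine ⟨rfl, fun x hx => ?_⟩
  rw [Multiset.mem_filter] at hx
  have := hpos x hx.1
  omega

/-- With all degrees equal to 1, the degree sum forces exactly two vertices. -/
theorem internalDegrees_ne_nil (hpos : ∀ x ∈ D, 1 ≤ x) (hsum : D.sum + 2 = 2 * D.card)
    (hcard : 3 ≤ D.card) : internalDegrees D ≠ [] := by
  intro h
  obtain ⟨L, hL⟩ := coe_internalDegrees_add hpos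
  rw [h] at hL
  rw [hL] at hsum hcard
  simp at hsum hcard
  omega

/-- The relation between degree sum and number of vertices determines the number of leaves from the
internal degrees. -/
theorem AlternatingInvariant.isTreeWithDegrees (hpos : ∀ x ∈ D, 1 ≤ x)
    (hsum : D.sum + 2 = 2 * D.card) {W : Type*} [Fintype W] {G : SimpleGraph W}
    (h : AlternatingInvariant (internalDegrees D) G) : IsTreeWithDegrees D G := by
  refine ⟨h.isTree, ?_⟩
  obtain ⟨L, hL⟩ := coe_internalDegrees_add hpos
  obtain ⟨L', -, hL'⟩ := h.degreeSequence_eq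
  have h1 := sum_deg_of_isTree h.isTree
  rw [sum_comp_deg G fun x => x, ← card_degreeSequence G, hL', Multiset.map_id'] at h1
  generalize internalDegrees D = I at *
  subst hL
  simp only [Multiset.sum_add, Multiset.card_add, Multiset.sum_replicate,
    Multiset.card_replicate, smul_eq_mul, mul_one] at h1 hsum
  rw [hL', show L' = L by omega]

end

end
end SomborTrees

/-! ### Assembly of the main theorem -/

theorem mainTheorem1 (D : Multiset ℕ) (hcard : 3 ≤ D.card)
    (hD : ∃ T : SimpleGraph (Fin D.card), SomborTrees.IsTreeWithDegrees D T) :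
    (SomborTrees.IsTreeWithDegrees D (SomborTrees.greedyTree D) ∧
      ∀ (V : Type*) [Fintype V] (T : SimpleGraph V), SomborTrees.IsTreeWithDegrees D T →
        SomborTrees.somborIndex (SomborTrees.greedyTree D) ≤ SomborTrees.somborIndex T) ∧
    (∃ A : SimpleGraph (Fin D.card), SomborTrees.IsAlternatingGreedyTree D A) ∧
    (∀ (W : Type*) [Fintype W] (A : SimpleGraph W), SomborTrees.IsAlternatingGreedyTree D A →
      SomborTrees.IsTreeWithDegrees D A ∧
      ∀ (V : Type*) [Fintype V] (T : SimpleGraph V), SomborTrees.IsTreeWithDegrees D T →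
        SomborTrees.somborIndex T ≤ SomborTrees.somborIndex A) := by
  obtain ⟨T₀, hT₀⟩ := hD
  have hpos := hT₀.one_le (by omega)
  have hsum := hT₀.sum_add_two
  have hbuild : ∀ {W : Type} {H : SimpleGraph W},
      SomborTrees.AlternatingGreedyBuild (SomborTrees.internalDegrees D) W H →
      ∃ _ : Fintype W, SomborTrees.AlternatingInvariant (SomborTrees.internalDegrees D) H :=
    fun h => SomborTrees.alternatingInvariant_of_build h (SomborTrees.internalDegrees_pairwise D)
      (SomborTrees.two_le_of_mem_internalDegrees D)
  refine ⟨?_, ?_, ?_⟩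
  · obtain ⟨h1, h2⟩ := SomborTrees.isTreeWithDegrees_greedyTree hpos hsum
    exact ⟨h1, fun V _ T hT =>
      SomborTrees.somborIndex_le_of_highCount (h1.2.trans hT.2.symm) hT.1 h2⟩
  · obtain ⟨W, H, hH⟩ := SomborTrees.exists_alternatingGreedyBuild _
      (SomborTrees.internalDegrees_ne_nil hpos hsum hcard)
      (SomborTrees.internalDegrees_pairwise D) (SomborTrees.two_le_of_mem_internalDegrees D)
    obtain ⟨inst, hinv⟩ := hbuild hH
    have h1 := hinv.isTreeWithDegrees hpos hsum
    have h2 : Fintype.card W = D.card := by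
      rw [← SomborTrees.card_degreeSequence H, h1.2]
    -- The recursion builds its own vertex type, so the tree is transported to `Fin D.card`.
    exact ⟨H.overFin h2, W, H, hH, ⟨(H.overFinIso h2).symm⟩⟩
  · rintro W _ A ⟨W', H, hH, ⟨e⟩⟩
    obtain ⟨inst, hinv⟩ := hbuild hH
    have h1 := hinv.isTreeWithDegrees hpos hsum
    refine ⟨⟨e.isTree_iff.mpr h1.1, (SomborTrees.degreeSequence_iso e).trans h1.2⟩,
      fun V _ T hT => ?_⟩
    rw [SomborTrees.somborIndex_iso e]
    exact SomborTrees.somborIndex_le_of_attainsMixedBound (h1.2.trans hT.2.symm) hT.1 hinv.attains
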